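/- Let $l/k$ be an unramified quadratic extension of non-archimedean local fields with non-trivial automorphism $c$ (also written $x\mapsto\bar x$), and let $U(k)=\{g\in GL_n(l): {}^t\bar g\,w\,g=w\}$, with $w$ the antidiagonal matrix with all antidiagonal entries $1$, be the group of $k$-points of the quasi-split unitary group in $n$ variables. Let $P$ (resp. $P_l$) be the subgroup of upper triangular matrices of $U(k)$ (resp. $GL_n(l)$), and $K=U(k)\cap GL_n(\mathcal O_l)$ (resp. $K_l=GL_n(\mathcal O_l)$). An unramified representation is an irreducible smooth complex representation with a non-zero vector fixed by $K$ (resp. $K_l$). For $t\in(\mathbb C^\times)^n$ let $\chi_t(b)=\prod_i t_i^{\operatorname{ord}_l(b_{ii})}$, an unramified character of $P$ (resp. $P_l$), and let $i(\chi_t)$ be the normalized smooth induction, i.e. the space of functions $\phi$ on $U(k)$ (resp. $GL_n(l)$), right invariant under some open subgroup, with $\phi(pg)=\delta^{1/2}(p)\chi_t(p)\phi(g)$ for $p\in P$ (resp. $P_l$), where $\delta$ is the modulus character, with the group acting by right translation. An unramified representation has Satake parameter $t$ if it is isomorphic to a subquotient of $i(\chi_t)$. An unramified representation $\Pi$ of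 $GL_n(l)\cong U(l)$ is the unramified base change $BC(\pi)$ of an unramified representation $\pi$ of $U(k)$ if $\pi$ has a Satake parameter and, for every Satake parameter $t$ of $\pi$, $\Pi$ has Satake parameter $(t_i/t_{n+1-i})_{1\le i\le n}$, the torus component of $(t\rtimes\mathrm{Frob})^2$ in the $L$-group of $U$. For $\sigma\in\operatorname{Aut}(\mathbb C)$ and a complex representation $V$, write ${}^\sigma V=V\otimes_{\mathbb C,\sigma}\mathbb C$. **Proposition.** Let $\pi$ be an unramified representation of $U(k)$ with unramified base change $BC(\pi)$, and let $\sigma\in\operatorname{Aut}(\mathbb C)$. Then ${}^\sigma\pi$ is unramified, ${}^\sigma(BC(\pi))$ is an unramified base change of ${}^\sigma\pi$, and every unramified base change of ${}^\sigma\pi$ is isomorphic to it; that is, $BC({}^\sigma\pi)\cong{}^\sigma(BC(\pi))$. -/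

import Mathlib

open scoped ValuativeRel

noncomputable section

namespace UnramifiedBC

/-! ### Smooth representations, conjugation by `σ`, normalized induction -/

section Abstract

/-- The complex vector space `V ⊗_{ℂ, σ} ℂ`, realized on the abelian group `V` with the scalar
multiplication `z • v = σ⁻¹(z) v`; the identification is `v ⊗ z ↦ σ⁻¹(z) v`, with inverse
`v ↦ v ⊗ 1`. -/
def Twist (_σ : ℂ ≃+* ℂ) (V : Type*) : Type _ := V

instance (σ : ℂ ≃+* ℂ) (V : Type*) [AddCommGroup V] : AddCommGroup (Twist σ V) :=
  inferInstanceAs (AddCommGroup V)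

instance (σ : ℂ ≃+* ℂ) (V : Type*) [AddCommGroup V] [Module ℂ V] : Module ℂ (Twist σ V) :=
  Module.compHom V (σ.symm : ℂ →+* ℂ)

/-- The conjugate representation `^σπ` on `V ⊗_{ℂ, σ} ℂ`, with `G` acting on the first factor. -/
def conjRep (σ : ℂ ≃+* ℂ) {G : Type*} [Group G] {V : Type*} [AddCommGroup V] [Module ℂ V]
    (π : Representation ℂ G V) : Representation ℂ G (Twist σ V) where
  toFun g :=
    { toFun := fun v => π g (show V from v)
      map_add' := fun v w => (π g).map_add (show V from v) (show V from w)
      map_smul' := fun z v => (π g).map_smul (σ.symm z) (show V from v) }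
  map_one' := by
    ext v
    change π 1 (show V from v) = v
    rw [map_one]
    rfl
  map_mul' g h := by
    ext v
    change π (g * h) (show V from v) = π g (π h (show V from v))
    rw [map_mul]
    rfl

variable {G : Type*} [Group G] [TopologicalSpace G]

/-- Every vector has an open stabilizer. -/
def IsSmoothRep {V : Type*} [AddCommGroup V] [Module ℂ V] (π : Representation ℂ G V) : Prop :=
  ∀ v : V, IsOpen {g : G | π g v = v}

/-- An unramified (with respect to the compact open subgroup `K`) representation of `G`: an
irreducible smooth representation with a nonzero vector fixed by `K`. -/
structure IsUnramified (K : Subgroup G) {V : Type*} [AddCommGroup V] [Module ℂ V]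
    (π : Representation ℂ G V) : Prop where
  irreducible : π.IsIrreducible
  smooth : IsSmoothRep π
  exists_fixed : ∃ v : V, v ≠ 0 ∧ ∀ κ ∈ K, π κ v = v

variable [IsTopologicalGroup G]

/-- `δ_P^{1/2}`, where `δ_P` is the modulus character of the closed subgroup `P`. -/
def sqrtModulus (P : Subgroup G) [LocallyCompactSpace P] (p : P) : ℂ :=
  ((NNReal.sqrt (MeasureTheory.Measure.modularCharacter p) : ℝ) : ℂ)

/-- The space of the normalized (unitary) smooth parabolic induction `i_P^G(χ)`: functions
`φ : G → ℂ` with `φ(pg) = δ_P^{1/2}(p) χ(p) φ(g)` that are right invariant under an open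
subgroup. -/
def inducedSpace (P : Subgroup G) [LocallyCompactSpace P] (χ : P →* ℂˣ) :
    Submodule ℂ (G → ℂ) where
  carrier := {φ | (∀ (p : P) (g : G), φ (p * g) = sqrtModulus P p * (χ p : ℂ) * φ g) ∧
    ∃ H : OpenSubgroup G, ∀ h ∈ H, ∀ g : G, φ (g * h) = φ g}
  add_mem' := by
    rintro φ ψ ⟨h1, H1, h2⟩ ⟨h3, H2, h4⟩
    refine ⟨fun p g => ?_, H1 ⊓ H2, fun h hh g => ?_⟩
    · simp only [Pi.add_apply, h1, h3]; ring
    · simp only [Pi.add_apply, h2 h hh.1, h4 h hh.2]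
  zero_mem' := ⟨by simp, ⊤, by simp⟩
  smul_mem' := by
    rintro z φ ⟨h1, H1, h2⟩
    refine ⟨fun p g => ?_, H1, fun h hh g => ?_⟩
    · simp only [Pi.smul_apply, h1, smul_eq_mul]; ring
    · simp only [Pi.smul_apply, h2 h hh]

/-- `i_P^G(χ)`: the group `G` acts by right translation. -/
def inducedRep (P : Subgroup G) [LocallyCompactSpace P] (χ : P →* ℂˣ) :
    Representation ℂ G (inducedSpace P χ) where
  toFun x :=
    { toFun := fun φ => ⟨fun g => φ.1 (g * x), by
        obtain ⟨φ, h1, H, h2⟩ := φ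
        refine ⟨fun p g => by simp only [mul_assoc, h1],
          H.comap (MulAut.conj x⁻¹).toMonoidHom ?_, fun h hh g => ?_⟩
        · change Continuous fun y : G => x⁻¹ * y * (x⁻¹)⁻¹
          fun_prop
        · have h3 : x⁻¹ * h * x ∈ H := by simpa using hh
          have h4 := h2 _ h3 (g * x)
          simpa [mul_assoc] using h4⟩
      map_add' := fun _ _ => rfl
      map_smul' := fun _ _ => rfl }
  map_one' := by ext φ g; simp
  map_mul' x y := by ext φ g; simp [mul_assoc]

/-- `π` is isomorphic to a subquotient of `ρ`: there are a subrepresentation `W` of `ρ` and a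
surjective intertwining map from `W` onto `π`. -/
def IsSubquotient {V W : Type*} [AddCommGroup V] [Module ℂ V] [AddCommGroup W] [Module ℂ W]
    (π : Representation ℂ G V) (ρ : Representation ℂ G W) : Prop :=
  ∃ (W' : Subrepresentation ρ) (f : Representation.IntertwiningMap W'.toRepresentation π),
    Function.Surjective f

end Abstract

/-! ### The groups -/

section Groups

variable (l : Type*) [Field l] [ValuativeRel l] [TopologicalSpace l]
  [IsNonarchimedeanLocalField l]

/-- The normalized additive valuation of the local field `l` (with `ord 0 = 0`). -/
def ord (x : l) : ℤ :=
  -WithZero.log (IsNonarchimedeanLocalField.valueGroupWithZeroIsoInt l (ValuativeRel.valuation l x))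

variable {l} in
theorem ord_mul {x y : l} (hx : x ≠ 0) (hy : y ≠ 0) : ord l (x * y) = ord l x + ord l y := by
  unfold ord
  rw [map_mul, map_mul, WithZero.log_mul (by simpa using hx) (by simpa using hy)]
  ring

theorem ord_one : ord l 1 = 0 := by simp [ord]

variable (n : ℕ)

/-- The upper triangular subgroup of `GL_n(l)`. -/
def borelGL : Subgroup (GL (Fin n) l) where
  carrier := {g | (g : Matrix (Fin n) (Fin n) l).IsUpperTriangular}
  mul_mem' := fun {g h} hg hh => by
    change (((g * h : GL (Fin n) l)) : Matrix (Fin n) (Fin n) l).IsUpperTriangular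
    rw [Units.val_mul]
    exact Matrix.BlockTriangular.mul hg hh
  one_mem' := by
    change ((1 : GL (Fin n) l) : Matrix (Fin n) (Fin n) l).IsUpperTriangular
    rw [Units.val_one]
    exact Matrix.blockTriangular_one
  inv_mem' := fun {g} hg => by
    change ((g⁻¹ : GL (Fin n) l) : Matrix (Fin n) (Fin n) l).IsUpperTriangular
    rw [Matrix.coe_units_inv]
    have : Invertible (g : Matrix (Fin n) (Fin n) l) := g.invertible
    exact Matrix.blockTriangular_inv_of_blockTriangular hg

/-- `GL_n(𝒪_l)`, as a subgroup of `GL_n(l)`. -/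
def maxCompactGL : Subgroup (GL (Fin n) l) :=
  (Matrix.GeneralLinearGroup.map (n := Fin n) (Subring.subtype 𝒪[l])).range

variable {l n}

theorem borelGL_diag_ne_zero (b : borelGL l n) (i : Fin n) : (b : GL (Fin n) l) i i ≠ 0 := by
  have h1 : ((b : GL (Fin n) l) : Matrix (Fin n) (Fin n) l).det ≠ 0 :=
    (Matrix.isUnits_det_units (b : GL (Fin n) l)).ne_zero
  rw [Matrix.det_of_isUpperTriangular b.2] at h1
  exact fun h => h1 (Finset.prod_eq_zero (Finset.mem_univ i) h)

theorem borelGL_diag_mul (b b' : borelGL l n) (i : Fin n) :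
    ((b * b' : borelGL l n) : GL (Fin n) l) i i
      = (b : GL (Fin n) l) i i * (b' : GL (Fin n) l) i i := by
  change (((b : GL (Fin n) l) : Matrix (Fin n) (Fin n) l) *
    ((b' : GL (Fin n) l) : Matrix (Fin n) (Fin n) l)) i i = _
  rw [Matrix.mul_apply, Finset.sum_eq_single i]
  · intro j _ hj
    rcases lt_or_gt_of_ne hj with h | h
    · rw [show ((b : GL (Fin n) l) : Matrix (Fin n) (Fin n) l) i j = 0 from b.2 h, zero_mul]
    · rw [show ((b' : GL (Fin n) l) : Matrix (Fin n) (Fin n) l) j i = 0 from b'.2 h, mul_zero]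
  · simp

/-- The unramified character `b ↦ ∏ i, t_i ^ ord(b_ii)` of the diagonal torus of `GL_n(l)`
attached to the element `t = diag(t_1, …, t_n)` of the dual torus, inflated to the upper
triangular group. -/
def unramifiedChar (t : Fin n → ℂˣ) : borelGL l n →* ℂˣ where
  toFun b := ∏ i, t i ^ ord l ((b : GL (Fin n) l) i i)
  map_one' := by simp [ord_one]
  map_mul' b b' := by
    rw [← Finset.prod_mul_distrib]
    refine Finset.prod_congr rfl fun i _ => ?_
    rw [borelGL_diag_mul, ord_mul (borelGL_diag_ne_zero b i) (borelGL_diag_ne_zero b' i), zpow_add]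

variable {k : Type*} [Field k] [Algebra k l]

variable (n) in
/-- The `k`-points of the quasi-split unitary group in `n` variables of the quadratic extension
`l/k` with conjugation `c`: the unitary group of the antidiagonal hermitian form
`x, y ↦ ∑ i, c(x_i) y_{n+1-i}`, for which the upper triangular matrices form a Borel subgroup. -/
def unitaryGroup (c : l ≃ₐ[k] l) : Subgroup (GL (Fin n) l) where
  carrier := {g | ((g : Matrix (Fin n) (Fin n) l).map c).transpose *
    (Matrix.of fun i j : Fin n => if j = i.rev then (1 : l) else 0) *
      (g : Matrix (Fin n) (Fin n) l) =
    Matrix.of fun i j : Fin n => if j = i.rev then (1 : l) else 0}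
  one_mem' := by simp
  mul_mem' := fun {g h} hg hh => by
    simp only [Set.mem_ofPred_eq, Units.val_mul] at hg hh ⊢
    rw [Matrix.map_mul, Matrix.transpose_mul]
    conv_rhs => rw [← hh, ← hg]
    simp only [Matrix.mul_assoc]
  inv_mem' := fun {g} hg => by
    simp only [Set.mem_ofPred_eq] at hg ⊢
    have h1 : (g : Matrix (Fin n) (Fin n) l) * ((g⁻¹ : GL (Fin n) l) : Matrix (Fin n) (Fin n) l)
        = 1 := by rw [← Units.val_mul, mul_inv_cancel, Units.val_one]
    have h2 : (((g⁻¹ : GL (Fin n) l) : Matrix (Fin n) (Fin n) l).map c).transpose *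
        ((g : Matrix (Fin n) (Fin n) l).map c).transpose = 1 := by
      rw [← Matrix.transpose_mul, ← Matrix.map_mul, h1]
      simp
    conv_lhs => rw [← hg]
    simp only [Matrix.mul_assoc]
    rw [h1, Matrix.mul_one, ← Matrix.mul_assoc, h2, Matrix.one_mul]

/-- The Borel subgroup `P` of `U(k)`: its upper triangular elements. -/
def borelU (c : l ≃ₐ[k] l) : Subgroup (unitaryGroup n c) :=
  (borelGL l n).subgroupOf (unitaryGroup n c)

/-- The hyperspecial maximal compact subgroup `U(𝒪_k) = U(k) ∩ GL_n(𝒪_l)` of `U(k)`. -/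
def maxCompactU (c : l ≃ₐ[k] l) : Subgroup (unitaryGroup n c) :=
  (maxCompactGL l n).subgroupOf (unitaryGroup n c)

/-- The restriction to the Borel subgroup of `U(k)` of the character attached to `t`. For `l/k`
unramified, `b ↦ (ord b_ii)_i` identifies the quotient of the diagonal torus of `U(k)` by its
maximal compact subgroup with the Frobenius invariant cocharacters `(λ_i)_i`,
`λ_{n+1-i} = -λ_i`, of the torus, i.e. with the Frobenius invariant characters of the dual torus,
so that this is the unramified character of `U(k)` with parameter `t ⋊ Frob`; every unramified
character arises in this way. -/
def unramifiedCharU (c : l ≃ₐ[k] l) (t : Fin n → ℂˣ) : borelU (n := n) c →* ℂˣ :=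
  (unramifiedChar t).comp
    (((unitaryGroup n c).subtype.comp (borelU c).subtype).codRestrict (borelGL l n)
      fun b => b.2)

end Groups

/-! ### Local compactness of the Borel subgroups -/

section Topology

variable {l : Type*} [Field l] [ValuativeRel l] [TopologicalSpace l]
  [IsNonarchimedeanLocalField l] {n : ℕ}

instance : T2Space l := by
  let := IsTopologicalAddGroup.rightUniformSpace l
  have := isUniformAddGroup_of_addCommGroup (G := l)
  infer_instance

instance : LocallyCompactSpace (Matrix (Fin n) (Fin n) l) :=
  inferInstanceAs (LocallyCompactSpace (Fin n → Fin n → l))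

instance : LocallyCompactSpace (GL (Fin n) l) :=
  inferInstanceAs (LocallyCompactSpace (Matrix (Fin n) (Fin n) l)ˣ)

theorem isClosed_borelGL : IsClosed (borelGL l n : Set (GL (Fin n) l)) := by
  have h : (borelGL l n : Set (GL (Fin n) l)) =
      ⋂ (i : Fin n) (j : Fin n) (_ : j < i),
        {g : GL (Fin n) l | (g : Matrix (Fin n) (Fin n) l) i j = 0} := by
    ext g
    simp only [Set.mem_iInter, Set.mem_ofPred_eq]
    exact Iff.rfl
  rw [h]
  refine isClosed_iInter fun i => isClosed_iInter fun j => isClosed_iInter fun _ => ?_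
  exact isClosed_eq (Units.continuous_val.matrix_elem i j) continuous_const

instance : LocallyCompactSpace (borelGL l n) :=
  isClosed_borelGL.isClosedEmbedding_subtypeVal.locallyCompactSpace

variable {k : Type*} [Field k] [ValuativeRel k] [TopologicalSpace k]
  [IsNonarchimedeanLocalField k] [Algebra k l] [ValuativeExtension k l]

open Topology in
theorem continuous_algebraMap_localField : Continuous (algebraMap k l) := by
  refine continuous_of_continuousAt_zero (algebraMap k l).toAddMonoidHom ?_
  have hb := IsValuativeTopology.hasBasis_nhds_zero' l
  have hb' := IsValuativeTopology.hasBasis_nhds_zero' k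
  change Filter.Tendsto (algebraMap k l) (𝓝 0) (𝓝 (algebraMap k l 0))
  rw [map_zero, hb'.tendsto_iff hb]
  intro γ hγ
  obtain ⟨a, ha0, ha1⟩ := Valuation.IsNontrivial.exists_lt_one (v := ValuativeRel.valuation k)
  have h1 : ValuativeRel.valuation l (algebraMap k l a) < 1 := by
    rw [← ValuativeExtension.mapValueGroupWithZero_valuation,
      ← map_one (ValuativeExtension.mapValueGroupWithZero k l)]
    exact ValuativeExtension.mapValueGroupWithZero_strictMono ha1
  obtain ⟨m, hm⟩ := exists_pow_lt₀ h1 (Units.mk0 γ hγ)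
  refine ⟨ValuativeRel.valuation k a ^ m, pow_ne_zero _ ((ValuativeRel.valuation k).ne_zero_iff.mpr ha0), fun x hx => ?_⟩
  refine lt_trans ?_ hm
  have h2 := (ValuativeExtension.mapValueGroupWithZero_strictMono (A := k) (B := l)) hx
  rwa [map_pow, ValuativeExtension.mapValueGroupWithZero_valuation,
    ValuativeExtension.mapValueGroupWithZero_valuation] at h2

theorem continuous_algEquiv [FiniteDimensional k l] (c : l ≃ₐ[k] l) : Continuous c := by
  let := IsTopologicalAddGroup.rightUniformSpace k
  have := isUniformAddGroup_of_addCommGroup (G := k)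
  let : (Valued.v (R := k)).RankOne :=
    { hom' := (ValuativeRel.IsRankLeOne.nonempty (R := k)).some.emb.comp
        MonoidWithZeroHom.ValueGroup₀.embedding
      strictMono' := (ValuativeRel.IsRankLeOne.nonempty (R := k)).some.strictMono.comp
        MonoidWithZeroHom.ValueGroup₀.embedding_strictMono }
  let N : NontriviallyNormedField k :=
    Valued.toNontriviallyNormedField k (ValuativeRel.ValueGroupWithZero k)
  have hc : @CompleteSpace k N.toUniformSpace := inferInstanceAs (CompleteSpace k)
  have : ContinuousSMul k l := ⟨by
    simp only [Algebra.smul_def]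
    exact (continuous_algebraMap_localField.comp continuous_fst).mul continuous_snd⟩
  exact LinearMap.continuous_of_finiteDimensional (𝕜 := k) (E := l) (F' := l) c.toLinearMap

variable [FiniteDimensional k l] (c : l ≃ₐ[k] l)

theorem isClosed_unitaryGroup : IsClosed (unitaryGroup n c : Set (GL (Fin n) l)) := by
  refine isClosed_eq ?_ continuous_const
  have h : Continuous fun g : GL (Fin n) l => (g : Matrix (Fin n) (Fin n) l) :=
    Units.continuous_val
  exact ((h.matrix_map (continuous_algEquiv c)).matrix_transpose.matrix_mul
    continuous_const).matrix_mul h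

instance : LocallyCompactSpace (unitaryGroup n c) :=
  (isClosed_unitaryGroup c).isClosedEmbedding_subtypeVal.locallyCompactSpace

instance : LocallyCompactSpace (borelU (n := n) c) :=
  (IsClosed.preimage continuous_subtype_val
    isClosed_borelGL).isClosedEmbedding_subtypeVal.locallyCompactSpace

end Topology

/-! ### Satake parameters and base change -/

section BaseChange

/-- The Frobenius automorphism `t ↦ (t_{n+1-i}⁻¹)_i` of the diagonal dual torus of the
quasi-split unitary group in `n` variables. -/
def dualFrobenius (n : ℕ) : MulAut (Fin n → ℂˣ) where
  toFun t i := (t i.rev)⁻¹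
  invFun t i := (t i.rev)⁻¹
  left_inv t := by ext i; simp
  right_inv t := by ext i; simp
  map_mul' s t := by
    ext i
    simp [mul_comm]

/-- The action on the dual torus of the unramified Weil group of `k`, i.e. of the infinite cyclic
group generated by the Frobenius of `k`. -/
def weilAction (n : ℕ) : Multiplicative ℤ →* MulAut (Fin n → ℂˣ) :=
  zpowersHom _ (dualFrobenius n)

/-- The restriction to the unramified Weil group of `l` of the unramified Langlands parameter of
`U(k)` sending the Frobenius of `k` to `t ⋊ Frob`: the Frobenius of `l` is the square of the
Frobenius of `k`, so the parameter of `U(l) = GL_n(l)` obtained is the dual torus component of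
`(t ⋊ Frob)²`, that is `(t_i / t_{n+1-i})_i`. -/
def baseChangeParam {n : ℕ} (t : Fin n → ℂˣ) : Fin n → ℂˣ :=
  ((⟨t, Multiplicative.ofAdd 1⟩ : (Fin n → ℂˣ) ⋊[weilAction n] Multiplicative ℤ) ^ 2).left

theorem baseChangeParam_apply {n : ℕ} (t : Fin n → ℂˣ) (i : Fin n) :
    baseChangeParam t i = t i / t i.rev := by
  rw [baseChangeParam, pow_two, SemidirectProduct.mul_left]
  simp [weilAction, dualFrobenius, div_eq_mul_inv]

variable (k l : Type*) [Field k] [ValuativeRel k] [TopologicalSpace k]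
  [IsNonarchimedeanLocalField k] [Field l] [ValuativeRel l] [TopologicalSpace l]
  [IsNonarchimedeanLocalField l] [Algebra k l]

/-- The extension of local fields `l/k` is unramified: a uniformizer of `k` is a uniformizer of `l`
(the residue field extension is automatically separable, the residue fields being finite). -/
def IsUnramifiedExtension : Prop :=
  ∀ ϖ : 𝒪[k], Irreducible ϖ → ∃ ϖ' : 𝒪[l], Irreducible ϖ' ∧ (ϖ' : l) = algebraMap k l ϖ

variable {k l} {n : ℕ}

/-- `π` is the unramified representation of `GL_n(l)` with Satake parameter (the conjugacy class
of) `t`: it is unramified and is a subquotient of the unramified principal series attached to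
`t`. -/
structure HasSatakeParameterGL {V : Type*} [AddCommGroup V] [Module ℂ V]
    (π : Representation ℂ (GL (Fin n) l) V) (t : Fin n → ℂˣ) : Prop where
  unramified : IsUnramified (maxCompactGL l n) π
  isSubquotient : IsSubquotient π (inducedRep (borelGL l n) (unramifiedChar t))

variable [ValuativeExtension k l] [FiniteDimensional k l]

/-- `π` is the unramified representation of `U(k)` with Satake parameter (the conjugacy class of)
`t ⋊ Frob`: it is unramified and is a subquotient of the unramified principal series attached
to `t`. -/
structure HasSatakeParameterU (c : l ≃ₐ[k] l) {V : Type*} [AddCommGroup V] [Module ℂ V]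
    (π : Representation ℂ (unitaryGroup n c) V) (t : Fin n → ℂˣ) : Prop where
  unramified : IsUnramified (maxCompactU c) π
  isSubquotient : IsSubquotient π (inducedRep (borelU c) (unramifiedCharU c t))

/-- `ρ` is (isomorphic to) the unramified base change `BC(π)` to `U(l) = GL_n(l)` of the unramified representation
`π` of `U(k)`: the Satake parameter of `ρ` is the base change of that of `π`, for every
representative `t ⋊ Frob` of the latter. -/
structure IsBaseChange (c : l ≃ₐ[k] l) {V : Type*} [AddCommGroup V] [Module ℂ V]
    {W : Type*} [AddCommGroup W] [Module ℂ W]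
    (π : Representation ℂ (unitaryGroup n c) V) (ρ : Representation ℂ (GL (Fin n) l) W) :
    Prop where
  exists_param : ∃ t, HasSatakeParameterU c π t
  param : ∀ t, HasSatakeParameterU c π t → HasSatakeParameterGL ρ (baseChangeParam t)

end BaseChange

end UnramifiedBC

end

/-!
Conjugation by `σ` commutes with normalized parabolic induction as soon as `σ` fixes the values of
`δ^{1/2}`. So if `δ^{1/2}` is rational on both Borel subgroups, `^σπ` is a subquotient of
`i(χ_{σ(t)})` whenever `π` is one of `i(χ_t)`. As `t ↦ (t_i / t_{n+1-i})` commutes with `σ`, the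
conjugate of a base change of `π` is a base change of `^σπ`.

Uniqueness holds because an unramified subquotient of `i(χ_t)` is determined by `t`: by the Iwasawa
decomposition (`exists_borelGL_mul_maxCompactGL`) the space `i(χ_t)^K` is at most a line, and since
`K`-fixed vectors lift along quotients of smooth representations
(`IsSmoothRep.exists_fixed_lift`), two irreducible subquotients which both have `K`-fixed vectors
are isomorphic (`nonempty_equiv_of_isSubquotient`).

The substance is that the modular character of both Borel subgroups takes values in the squares of
rational numbers. Its value at `g` compares the indices of a small open subgroup in a compact open
subgroup and in its conjugate by `g` (`modularCharacter_mul_relIndex`). Conjugation by the torus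
contracts the unipotent radical, and the character is trivial on integral elements, so only diagonal
matrices `ϖ^λ` matter, where `ϖ` is a uniformizer of `k`
(`CayleyChart.exists_modularCharacter_eq`). A Cayley transform, which commutes with conjugation,
carries the small open subgroups to lattices in an additive group of upper triangular matrices, so
the indices can be counted coordinate by coordinate (`CayleyChart.modularCharacter_torus`). The
variant `X ↦ 1 + (1 - θX)⁻¹X` with `θ + c(θ) = 1` carries antihermitian to unitary matrices in every
characteristic and residue characteristic, including `2`. In coordinates ranging over `l` the
indices are powers of the residue cardinality of `l`, which is a square (`isSquare_latIndex_top`).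
In the unitary case the remaining coordinates lie on the antidiagonal and range over the elements of
trace zero; there the exponent `λ_i - λ_{n+1-i} = 2λ_i` is even.
-/

set_option linter.unusedSectionVars false

namespace UnramifiedBC

/-! ### Unramified subquotients of a smooth representation -/

section Abstract

variable {G : Type*} [Group G] [TopologicalSpace G]

/-- The orbit of a smooth vector under a compact group is finite, so a vector with `K`-fixed image
can be averaged to a `K`-fixed vector with the same image. -/
theorem IsSmoothRep.exists_fixed_lift [IsTopologicalGroup G] {K : Subgroup G}
    (hK : IsCompact (K : Set G)) {V W : Type*} [AddCommGroup V] [Module ℂ V] [AddCommGroup W]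
    [Module ℂ W] {ρ : Representation ℂ G W} {π : Representation ℂ G V} (hρ : IsSmoothRep ρ)
    (f : Representation.IntertwiningMap ρ π) {v : V} (hv : ∀ κ ∈ K, π κ v = v) {w : W}
    (hw : f w = v) : ∃ w', (∀ κ ∈ K, ρ κ w' = w') ∧ f w' = v := by
  classical
  have hcont : @Continuous G W _ ⊥ fun g => ρ g w := by
    let : TopologicalSpace W := ⊥
    have : DiscreteTopology W := ⟨rfl⟩
    refine IsLocallyConstant.continuous ((IsLocallyConstant.iff_exists_open _).2 fun g => ?_)
    refine ⟨(fun x => g⁻¹ * x) ⁻¹' {x | ρ x w = w},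
      (hρ w).preimage (continuous_const.mul continuous_id), by simp, fun x hx => ?_⟩
    have h1 : ρ (g⁻¹ * x) w = w := hx
    calc ρ x w = ρ (g * (g⁻¹ * x)) w := by rw [mul_inv_cancel_left]
      _ = ρ g w := by rw [map_mul, Module.End.mul_apply, h1]
  have hfin : ((fun g => ρ g w) '' (K : Set G)).Finite := by
    let : TopologicalSpace W := ⊥
    have : DiscreteTopology W := ⟨rfl⟩
    exact (hK.image hcont).finite_of_discrete
  set S : Finset W := hfin.toFinset with hS
  have hmem : ∀ x, x ∈ S ↔ ∃ g ∈ K, ρ g w = x := fun x => by simp [hS]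
  have hne : (S.card : ℂ) ≠ 0 := by
    have : w ∈ S := (hmem w).2 ⟨1, one_mem K, by simp⟩
    exact_mod_cast (Finset.card_pos.2 ⟨w, this⟩).ne'
  refine ⟨(S.card : ℂ)⁻¹ • ∑ x ∈ S, x, fun κ hκ => ?_, ?_⟩
  · rw [map_smul, map_sum]
    congr 1
    refine Finset.sum_bij' (fun x _ => ρ κ x) (fun x _ => ρ κ⁻¹ x) ?_ ?_ ?_ ?_ ?_
    · intro x hx
      obtain ⟨g, hg, rfl⟩ := (hmem x).1 hx
      exact (hmem _).2 ⟨κ * g, mul_mem hκ hg, by simp⟩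
    · intro x hx
      obtain ⟨g, hg, rfl⟩ := (hmem x).1 hx
      exact (hmem _).2 ⟨κ⁻¹ * g, mul_mem (inv_mem hκ) hg, by simp⟩
    · intro x _
      rw [← Module.End.mul_apply, ← map_mul]; simp
    · intro x _
      rw [← Module.End.mul_apply, ← map_mul]; simp
    · intro x _; rfl
  · have h1 : ∀ x ∈ S, f x = v := fun x hx => by
      obtain ⟨g, hg, rfl⟩ := (hmem x).1 hx
      rw [f.isIntertwining, hw, hv g hg]
    rw [map_smul, map_sum, Finset.sum_congr rfl h1, Finset.sum_const, ← Nat.cast_smul_eq_nsmul ℂ,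
      smul_smul, inv_mul_cancel₀ hne, one_smul]

theorem IsSmoothRep.toRepresentation {W : Type*} [AddCommGroup W] [Module ℂ W]
    {ρ : Representation ℂ G W} (hρ : IsSmoothRep ρ) (W' : Subrepresentation ρ) :
    IsSmoothRep W'.toRepresentation := fun v => by
  convert hρ (v : W) using 3 with g
  exact Subtype.ext_iff

/-- Two surjective intertwining maps with the same kernel have isomorphic targets. -/
theorem nonempty_equiv_of_ker_eq {V₁ V₂ W : Type*} [AddCommGroup V₁] [Module ℂ V₁]
    [AddCommGroup V₂] [Module ℂ V₂] [AddCommGroup W] [Module ℂ W] {ρ : Representation ℂ G W}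
    {π₁ : Representation ℂ G V₁} {π₂ : Representation ℂ G V₂}
    (f₁ : Representation.IntertwiningMap ρ π₁) (f₂ : Representation.IntertwiningMap ρ π₂)
    (h₁ : Function.Surjective f₁) (h₂ : Function.Surjective f₂)
    (h : ∀ w, f₁ w = 0 ↔ f₂ w = 0) : Nonempty (π₁.Equiv π₂) := by
  have hker : f₁.toLinearMap.ker = f₂.toLinearMap.ker := Submodule.ext h
  let e : V₁ ≃ₗ[ℂ] V₂ := (f₁.toLinearMap.quotKerEquivOfSurjective h₁).symm ≪≫ₗ
    Submodule.quotEquivOfEq _ _ hker ≪≫ₗ f₂.toLinearMap.quotKerEquivOfSurjective h₂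
  have he : ∀ w, e (f₁ w) = f₂ w := fun w => by
    have h3 : (f₁.toLinearMap.quotKerEquivOfSurjective h₁).symm (f₁ w) =
        Submodule.Quotient.mk w := by
      rw [LinearEquiv.symm_apply_eq]; rfl
    simp only [e, LinearEquiv.trans_apply, h3]
    rfl
  refine ⟨Representation.Equiv.mk e fun g => ?_⟩
  ext v
  obtain ⟨w, rfl⟩ := h₁ v
  change e (π₁ g (f₁ w)) = π₂ g (e (f₁ w))
  rw [← f₁.isIntertwining, he, he, f₂.isIntertwining]

/-- Suppose that the `K`-fixed vectors of `ρ` form the line through `φ`, and that `π₂` is unramified.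
A kernel avoiding `φ` is contained in the kernel of every intertwining map to `π₂`. -/
theorem eq_zero_of_map_fixed_ne_zero [IsTopologicalGroup G] {K : Subgroup G}
    (hK : IsCompact (K : Set G)) {V₁ V₂ W : Type*} [AddCommGroup V₁] [Module ℂ V₁]
    [AddCommGroup V₂] [Module ℂ V₂] [AddCommGroup W] [Module ℂ W] {ρ : Representation ℂ G W}
    {π₁ : Representation ℂ G V₁} {π₂ : Representation ℂ G V₂} (hρ : IsSmoothRep ρ)
    (hline : ∀ φ ψ : W, (∀ κ ∈ K, ρ κ φ = φ) → (∀ κ ∈ K, ρ κ ψ = ψ) → φ ≠ 0 →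
      ∃ z : ℂ, ψ = z • φ)
    (g₁ : Representation.IntertwiningMap ρ π₁) (g₂ : Representation.IntertwiningMap ρ π₂)
    (hπ₂ : IsUnramified K π₂) {φ : W} (hφ : ∀ κ ∈ K, ρ κ φ = φ) (hg₁ : g₁ φ ≠ 0) (w : W)
    (hw : g₁ w = 0) : g₂ w = 0 := by
  have := hπ₂.irreducible
  obtain ⟨v, hv, hfix⟩ := hπ₂.exists_fixed
  let h : Representation.IntertwiningMap g₁.ker.toRepresentation π₂ :=
    ⟨g₂.toLinearMap ∘ₗ g₁.ker.toSubmodule.subtype, fun g => by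
      ext x
      exact g₂.isIntertwining _ _ g x.1⟩
  rcases Representation.IsIrreducible.surjective_or_eq_zero h with hs | h0
  · obtain ⟨x, hx⟩ := hs v
    obtain ⟨y, hy, hyv⟩ := (hρ.toRepresentation g₁.ker).exists_fixed_lift hK h hfix hx
    have hy0 : (y.1 : W) ≠ 0 := fun h0 => hv (by
      rw [← hyv, show y = 0 from Subtype.ext h0, map_zero])
    obtain ⟨a, ha⟩ := hline y.1 φ (fun κ hκ => congrArg Subtype.val (hy κ hκ)) hφ hy0
    refine absurd ?_ hg₁
    have h6 : g₁ y.1 = 0 := y.2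
    rw [ha, map_smul, h6, smul_zero]
  · exact DFunLike.congr_fun h0 (⟨w, hw⟩ : g₁.ker.toSubmodule)

/-- If the space of `K`-fixed vectors of a smooth representation `I` is at most a line, then `I`
has at most one unramified irreducible subquotient: the line is contained in any subrepresentation
with such a quotient, and the kernel is the largest subrepresentation avoiding the line. -/
theorem nonempty_equiv_of_isSubquotient [IsTopologicalGroup G] {K : Subgroup G}
    (hK : IsCompact (K : Set G)) {V₁ V₂ W : Type*} [AddCommGroup V₁] [Module ℂ V₁]
    [AddCommGroup V₂] [Module ℂ V₂] [AddCommGroup W] [Module ℂ W] {ρ : Representation ℂ G W}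
    {π₁ : Representation ℂ G V₁} {π₂ : Representation ℂ G V₂} (hρ : IsSmoothRep ρ)
    (hline : ∀ φ ψ : W, (∀ κ ∈ K, ρ κ φ = φ) → (∀ κ ∈ K, ρ κ ψ = ψ) → φ ≠ 0 →
      ∃ z : ℂ, ψ = z • φ)
    (hπ₁ : IsUnramified K π₁) (hπ₂ : IsUnramified K π₂)
    (h₁ : IsSubquotient π₁ ρ) (h₂ : IsSubquotient π₂ ρ) : Nonempty (π₁.Equiv π₂) := by
  obtain ⟨W₁, f₁, hf₁⟩ := h₁
  obtain ⟨W₂, f₂, hf₂⟩ := h₂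
  have := hπ₁.irreducible
  have := hπ₂.irreducible
  obtain ⟨v₁, hv₁, hfix₁⟩ := hπ₁.exists_fixed
  obtain ⟨v₂, hv₂, hfix₂⟩ := hπ₂.exists_fixed
  obtain ⟨w₁, hw₁⟩ := hf₁ v₁
  obtain ⟨w₂, hw₂⟩ := hf₂ v₂
  obtain ⟨φ₁, hφ₁, hφv₁⟩ := (hρ.toRepresentation W₁).exists_fixed_lift hK f₁ hfix₁ hw₁
  obtain ⟨φ₂, hφ₂, hφv₂⟩ := (hρ.toRepresentation W₂).exists_fixed_lift hK f₂ hfix₂ hw₂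
  have hφ₁' : ∀ κ ∈ K, ρ κ φ₁ = φ₁ := fun κ hκ => congrArg Subtype.val (hφ₁ κ hκ)
  have hφ₂' : ∀ κ ∈ K, ρ κ φ₂ = φ₂ := fun κ hκ => congrArg Subtype.val (hφ₂ κ hκ)
  have hne₁ : (φ₁ : W) ≠ 0 := fun h0 => hv₁ (by
    rw [← hφv₁, show φ₁ = 0 from Subtype.ext h0, map_zero])
  have hne₂ : (φ₂ : W) ≠ 0 := fun h0 => hv₂ (by
    rw [← hφv₂, show φ₂ = 0 from Subtype.ext h0, map_zero])
  obtain ⟨z, hz⟩ := hline φ₁ φ₂ hφ₁' hφ₂' hne₁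
  have hz0 : z ≠ 0 := fun h => hne₂ (by rw [hz, h, zero_smul])
  have hmem₁₂ : (φ₁ : W) ∈ W₂.toSubmodule := by
    have : (φ₁ : W) = z⁻¹ • (φ₂ : W) := by rw [hz, smul_smul, inv_mul_cancel₀ hz0, one_smul]
    rw [this]
    exact W₂.toSubmodule.smul_mem _ φ₂.2
  let M : Subrepresentation ρ := W₁ ⊓ W₂
  let g₁ : Representation.IntertwiningMap M.toRepresentation π₁ :=
    ⟨f₁.toLinearMap ∘ₗ Submodule.inclusion inf_le_left, fun g => by
      ext w
      exact f₁.isIntertwining _ _ g ⟨w.1, w.2.1⟩⟩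
  let g₂ : Representation.IntertwiningMap M.toRepresentation π₂ :=
    ⟨f₂.toLinearMap ∘ₗ Submodule.inclusion inf_le_right, fun g => by
      ext w
      exact f₂.isIntertwining _ _ g ⟨w.1, w.2.2⟩⟩
  let φ : M.toSubmodule := ⟨φ₁, φ₁.2, hmem₁₂⟩
  have hφ : ∀ κ ∈ K, M.toRepresentation κ φ = φ := fun κ hκ => Subtype.ext (hφ₁' κ hκ)
  have hgφ₁ : g₁ φ ≠ 0 := by
    have : g₁ φ = v₁ := hφv₁
    rwa [this]
  have hgφ₂ : g₂ φ ≠ 0 := by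
    have h3 : φ₂ = z • (⟨φ₁, hmem₁₂⟩ : W₂.toSubmodule) := Subtype.ext hz
    have h4 : v₂ = z • g₂ φ := by rw [← hφv₂, h3, map_smul]; rfl
    exact fun h0 => hv₂ (by rw [h4, h0, smul_zero])
  have hline' : ∀ φ ψ : M.toSubmodule, (∀ κ ∈ K, M.toRepresentation κ φ = φ) →
      (∀ κ ∈ K, M.toRepresentation κ ψ = ψ) → φ ≠ 0 → ∃ z : ℂ, ψ = z • φ := by
    intro φ ψ hφ hψ h0
    obtain ⟨z, hz⟩ := hline φ ψ (fun κ hκ => congrArg Subtype.val (hφ κ hκ))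
      (fun κ hκ => congrArg Subtype.val (hψ κ hκ)) fun h => h0 (Subtype.ext h)
    exact ⟨z, Subtype.ext hz⟩
  have hs₁ : Function.Surjective g₁ :=
    (Representation.IsIrreducible.surjective_or_eq_zero g₁).resolve_right fun h =>
      hgφ₁ (by rw [h]; rfl)
  have hs₂ : Function.Surjective g₂ :=
    (Representation.IsIrreducible.surjective_or_eq_zero g₂).resolve_right fun h =>
      hgφ₂ (by rw [h]; rfl)
  exact nonempty_equiv_of_ker_eq g₁ g₂ hs₁ hs₂ fun w =>
    ⟨eq_zero_of_map_fixed_ne_zero hK (hρ.toRepresentation M) hline' g₁ g₂ hπ₂ hφ hgφ₁ w,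
      eq_zero_of_map_fixed_ne_zero hK (hρ.toRepresentation M) hline' g₂ g₁ hπ₁ hφ hgφ₂ w⟩

end Abstract

/-! ### Conjugation by an automorphism of the complex numbers -/

section Conj

variable (σ : ℂ ≃+* ℂ) {G : Type*} [Group G] {V : Type*} [AddCommGroup V] [Module ℂ V]
  {π : Representation ℂ G V}

/-- `π` and `^σπ` have the same stable subspaces. -/
def subrepresentationConjEquiv (π : Representation ℂ G V) :
    Subrepresentation (conjRep σ π) ≃o Subrepresentation π where
  toFun S :=
    { toSubmodule :=
        { carrier := {v : V | (show Twist σ V from v) ∈ S.toSubmodule}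
          add_mem' := fun ha hb => S.toSubmodule.add_mem ha hb
          zero_mem' := S.toSubmodule.zero_mem
          smul_mem' := fun z v hv => by
            have h := S.toSubmodule.smul_mem (σ z) hv
            have h2 : (show V from (σ z • (show Twist σ V from v))) = z • v := by
              change σ.symm (σ z) • v = z • v
              rw [σ.symm_apply_apply]
            exact h2 ▸ h }
      apply_mem_toSubmodule := fun g v hv => S.apply_mem_toSubmodule g hv }
  invFun S :=
    { toSubmodule :=
        { carrier := {v : Twist σ V | (show V from v) ∈ S.toSubmodule}
          add_mem' := fun ha hb => S.toSubmodule.add_mem ha hb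
          zero_mem' := S.toSubmodule.zero_mem
          smul_mem' := fun z v hv => S.toSubmodule.smul_mem (σ.symm z) hv }
      apply_mem_toSubmodule := fun g v hv => S.apply_mem_toSubmodule g hv }
  left_inv _ := rfl
  right_inv _ := rfl
  map_rel_iff' := Iff.rfl

theorem IsUnramified.conjRep [TopologicalSpace G] {K : Subgroup G} (h : IsUnramified K π) :
    IsUnramified K (conjRep σ π) where
  irreducible := (subrepresentationConjEquiv σ π).isSimpleOrder_iff.2 h.irreducible
  smooth := h.smooth
  exists_fixed := h.exists_fixed

variable [TopologicalSpace G] [IsTopologicalGroup G]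

theorem isSmoothRep_inducedRep (P : Subgroup G) [LocallyCompactSpace P] (χ : P →* ℂˣ) :
    IsSmoothRep (inducedRep P χ) := by
  intro φ
  let S : Subgroup G :=
    { carrier := {g | inducedRep P χ g φ = φ}
      one_mem' := by simp
      mul_mem' := fun {a b} ha hb => by
        change inducedRep P χ (a * b) φ = φ
        rw [map_mul, Module.End.mul_apply, show inducedRep P χ b φ = φ from hb]
        exact ha
      inv_mem' := fun {a} ha => by
        change inducedRep P χ a⁻¹ φ = φ
        conv_lhs => rw [← show inducedRep P χ a φ = φ from ha, ← Module.End.mul_apply, ← map_mul]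
        simp }
  obtain ⟨H, hH⟩ := φ.2.2
  exact Subgroup.isOpen_mono (H₁ := H.toSubgroup) (H₂ := S)
    (fun h hh => Subtype.ext (funext fun g => hH h hh g)) H.isOpen

/-- `φ ↦ σ ∘ φ` carries `i(χ)` to `i(σ ∘ χ)` when `σ` fixes the values of `δ_P^{1/2}`. -/
theorem comp_mem_inducedSpace {P : Subgroup G} [LocallyCompactSpace P]
    (hδ : ∀ p : P, σ (sqrtModulus P p) = sqrtModulus P p) {χ χ' : P →* ℂˣ}
    (hχ : ∀ p, (χ' p : ℂ) = σ (χ p)) {φ : G → ℂ} (hφ : φ ∈ inducedSpace P χ) :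
    (fun g => σ (φ g)) ∈ inducedSpace P χ' := by
  obtain ⟨h1, H, h2⟩ := hφ
  refine ⟨fun p g => ?_, H, fun h hh g => ?_⟩
  · simp only [h1, map_mul, hδ, hχ]
  · simp only [h2 h hh]

theorem IsSubquotient.conjRep {P : Subgroup G} [LocallyCompactSpace P]
    (hδ : ∀ p : P, σ (sqrtModulus P p) = sqrtModulus P p) {χ χ' : P →* ℂˣ}
    (hχ : ∀ p, (χ' p : ℂ) = σ (χ p)) (h : IsSubquotient π (inducedRep P χ)) :
    IsSubquotient (conjRep σ π) (inducedRep P χ') := by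
  have hδ' : ∀ p : P, σ.symm (sqrtModulus P p) = sqrtModulus P p := fun p => by
    rw [σ.symm_apply_eq, hδ]
  have hχ' : ∀ p, (χ p : ℂ) = σ.symm (χ' p) := fun p => by rw [hχ, σ.symm_apply_apply]
  obtain ⟨W, f, hf⟩ := h
  -- `τ` is the inverse `ψ ↦ σ⁻¹ ∘ ψ` of `φ ↦ σ ∘ φ`.
  let τ : inducedSpace P χ' → inducedSpace P χ := fun ψ =>
    ⟨fun g => σ.symm (ψ.1 g), comp_mem_inducedSpace σ.symm hδ' hχ' ψ.2⟩
  let W' : Subrepresentation (inducedRep P χ') :=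
    { toSubmodule :=
        { carrier := {ψ | τ ψ ∈ W.toSubmodule}
          add_mem' := fun {a b} ha hb => by
            have h3 : τ (a + b) = τ a + τ b := Subtype.ext (funext fun g => map_add σ.symm _ _)
            change τ (a + b) ∈ W.toSubmodule
            rw [h3]
            exact W.toSubmodule.add_mem ha hb
          zero_mem' := by
            have h3 : τ 0 = 0 := Subtype.ext (funext fun g => map_zero σ.symm)
            change τ 0 ∈ W.toSubmodule
            rw [h3]
            exact W.toSubmodule.zero_mem
          smul_mem' := fun z a ha => by
            have h3 : τ (z • a) = σ.symm z • τ a :=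
              Subtype.ext (funext fun g => map_mul σ.symm _ _)
            change τ (z • a) ∈ W.toSubmodule
            rw [h3]
            exact W.toSubmodule.smul_mem _ ha }
      apply_mem_toSubmodule := fun g ψ hψ => W.apply_mem_toSubmodule g hψ }
  let F : W'.toSubmodule →ₗ[ℂ] Twist σ V :=
    { toFun := fun ψ => f ⟨τ ψ.1, ψ.2⟩
      map_add' := fun a b => by
        have h3 : (⟨τ (a + b).1, (a + b).2⟩ : W.toSubmodule) = ⟨τ a.1, a.2⟩ + ⟨τ b.1, b.2⟩ :=
          Subtype.ext (Subtype.ext (funext fun g => map_add σ.symm _ _))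
        rw [h3]
        exact map_add f _ _
      map_smul' := fun z a => by
        have h3 : (⟨τ (z • a).1, (z • a).2⟩ : W.toSubmodule) = σ.symm z • ⟨τ a.1, a.2⟩ :=
          Subtype.ext (Subtype.ext (funext fun g => map_mul σ.symm _ _))
        rw [h3]
        exact map_smul f _ _ }
  refine ⟨W', ⟨F, fun g => ?_⟩, fun v => ?_⟩
  · ext ψ
    exact f.isIntertwining _ _ g ⟨τ ψ.1, ψ.2⟩
  · obtain ⟨φ, hφ⟩ := hf v
    have h3 : τ ⟨fun g => σ (φ.1.1 g), comp_mem_inducedSpace σ hδ hχ φ.1.2⟩ = φ.1 :=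
      Subtype.ext (funext fun g => σ.symm_apply_apply _)
    refine ⟨⟨⟨fun g => σ (φ.1.1 g), comp_mem_inducedSpace σ hδ hχ φ.1.2⟩, ?_⟩, ?_⟩
    · change τ _ ∈ W.toSubmodule
      rw [h3]
      exact φ.2
    · rw [← hφ]
      exact congrArg f (Subtype.ext h3)

/-- The converse of `IsSubquotient.conjRep`: the identity of the abelian group `V` is an
isomorphism of `^{σ⁻¹}(^σπ)` onto `π`. -/
theorem IsSubquotient.of_conjRep {P : Subgroup G} [LocallyCompactSpace P]
    (hδ : ∀ p : P, σ (sqrtModulus P p) = sqrtModulus P p) {χ χ' : P →* ℂˣ}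
    (hχ : ∀ p, (χ' p : ℂ) = σ (χ p))
    (h : IsSubquotient (UnramifiedBC.conjRep σ π) (inducedRep P χ')) :
    IsSubquotient π (inducedRep P χ) := by
  have hδ' : ∀ p : P, σ.symm (sqrtModulus P p) = sqrtModulus P p := fun p => by
    rw [σ.symm_apply_eq, hδ]
  have hχ' : ∀ p, (χ p : ℂ) = σ.symm (χ' p) := fun p => by rw [hχ, σ.symm_apply_apply]
  obtain ⟨W, f, hf⟩ := h.conjRep σ.symm hδ' hχ'
  let e : Twist σ.symm (Twist σ V) →ₗ[ℂ] V :=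
    { toFun := fun v => v
      map_add' := fun _ _ => rfl
      map_smul' := fun z v => by
        change σ.symm (σ z) • (show V from v) = z • (show V from v)
        rw [σ.symm_apply_apply] }
  exact ⟨W, ⟨e ∘ₗ f.toLinearMap, fun g => by ext w; exact f.isIntertwining _ _ g w⟩, hf⟩

end Conj

/-! ### Lattices in a local field -/

section Lattices

variable {l : Type*} [Field l] [ValuativeRel l] [TopologicalSpace l]
  [IsNonarchimedeanLocalField l]

local notation "v" => ValuativeRel.valuation l

/-- `ϖ ∈ l` is a uniformizer of `𝒪_l`. -/
def IsUniformizer (ϖ : l) : Prop := ∃ ϖ' : 𝒪[l], Irreducible ϖ' ∧ (ϖ' : l) = ϖ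

theorem isUnit_integers_iff (x : 𝒪[l]) : IsUnit x ↔ v (x : l) = 1 :=
  (Valuation.integer.integers v).isUnit_iff_valuation_eq_one

variable {ϖ : l}

theorem IsUniformizer.ne_zero (hϖ : IsUniformizer ϖ) : ϖ ≠ 0 := by
  obtain ⟨p, hp, rfl⟩ := hϖ
  simpa using hp.ne_zero

theorem IsUniformizer.val_ne_zero (hϖ : IsUniformizer ϖ) : v ϖ ≠ 0 :=
  (Valuation.ne_zero_iff _).2 hϖ.ne_zero

theorem IsUniformizer.val_pos (hϖ : IsUniformizer ϖ) : 0 < v ϖ :=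
  zero_lt_iff.2 hϖ.val_ne_zero

theorem IsUniformizer.val_lt_one (hϖ : IsUniformizer ϖ) : v ϖ < 1 := by
  obtain ⟨p, hp, rfl⟩ := hϖ
  exact lt_of_le_of_ne p.2 fun h => hp.not_isUnit ((isUnit_integers_iff p).2 h)

theorem IsUniformizer.zpow_le_zpow (hϖ : IsUniformizer ϖ) {r s : ℤ} (h : r ≤ s) :
    v ϖ ^ s ≤ v ϖ ^ r :=
  zpow_le_zpow_right_of_le_one₀ hϖ.val_pos hϖ.val_lt_one.le h

theorem IsUniformizer.zpow_le_zpow_iff (hϖ : IsUniformizer ϖ) {r s : ℤ} :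
    v ϖ ^ s ≤ v ϖ ^ r ↔ r ≤ s :=
  zpow_le_zpow_iff_right_of_lt_one₀ hϖ.val_pos hϖ.val_lt_one

theorem IsUniformizer.exists_zpow_of_ne_zero (hϖ : IsUniformizer ϖ) {x : l} (hx : x ≠ 0) :
    ∃ m : ℤ, v x = v ϖ ^ m := by
  obtain ⟨p, hp, rfl⟩ := hϖ
  have key : ∀ y : l, y ≠ 0 → v y ≤ 1 → ∃ m : ℤ, v y = v (p : l) ^ m := fun y hy hy1 => by
    obtain ⟨m, u, hu⟩ := IsDiscreteValuationRing.eq_unit_mul_pow_irreducible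
      (x := (⟨y, hy1⟩ : 𝒪[l])) (fun h => hy (congrArg Subtype.val h)) hp
    refine ⟨m, ?_⟩
    have h1 : y = (u : 𝒪[l]) * (p : l) ^ m := congrArg Subtype.val hu
    rw [h1, map_mul, map_pow, (isUnit_integers_iff _).1 u.isUnit, one_mul, zpow_natCast]
  rcases le_total (v x) 1 with h | h
  · exact key x hx h
  · obtain ⟨m, hm⟩ := key x⁻¹ (inv_ne_zero hx) (by rw [map_inv₀]; exact inv_le_one_of_one_le₀ h)
    exact ⟨-m, by rw [zpow_neg, ← hm, map_inv₀, inv_inv]⟩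

/-- The fractional ideal `ϖ^r 𝒪_l`. -/
def ball (ϖ : l) (r : ℤ) : AddSubgroup l where
  carrier := {x | v x ≤ v ϖ ^ r}
  add_mem' := fun {a b} ha hb => by
    change v (a + b) ≤ v ϖ ^ r
    exact Valuation.map_add_le _ ha hb
  zero_mem' := by simp
  neg_mem' := fun {a} h => by
    change v (-a) ≤ v ϖ ^ r
    rw [Valuation.map_neg]
    exact h

theorem mem_ball {r : ℤ} {x : l} : x ∈ ball ϖ r ↔ v x ≤ v ϖ ^ r := Iff.rfl

theorem mem_ball_zero {x : l} : x ∈ ball ϖ 0 ↔ v x ≤ 1 := by rw [mem_ball, zpow_zero]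

theorem ball_mono (hϖ : IsUniformizer ϖ) {r s : ℤ} (h : r ≤ s) : ball ϖ s ≤ ball ϖ r :=
  fun _ hx => mem_ball.2 (le_trans (mem_ball.1 hx) (hϖ.zpow_le_zpow h))

theorem mul_mem_ball (hϖ : IsUniformizer ϖ) {r s : ℤ} {x y : l} (hx : x ∈ ball ϖ r)
    (hy : y ∈ ball ϖ s) : x * y ∈ ball ϖ (r + s) := by
  rw [mem_ball, map_mul, zpow_add₀ hϖ.val_ne_zero]
  exact mul_le_mul' hx hy

theorem exists_mem_ball (hϖ : IsUniformizer ϖ) (x : l) : ∃ r : ℤ, x ∈ ball ϖ r := by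
  rcases eq_or_ne x 0 with rfl | h0
  · exact ⟨0, zero_mem _⟩
  · obtain ⟨m, hm⟩ := hϖ.exists_zpow_of_ne_zero h0
    exact ⟨m, hm.le⟩

theorem zpow_mul_mem_ball (hϖ : IsUniformizer ϖ) {r m : ℤ} {x : l} :
    ϖ ^ m * x ∈ ball ϖ r ↔ x ∈ ball ϖ (r - m) := by
  rw [mem_ball, mem_ball, map_mul, map_zpow₀, zpow_sub₀ hϖ.val_ne_zero, le_div_iff₀, mul_comm]
  exact zpow_pos hϖ.val_pos m

theorem isCompact_ball (ϖ : l) (r : ℤ) : IsCompact (ball ϖ r : Set l) :=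
  IsNonarchimedeanLocalField.isCompact_closedBall l _

theorem isOpen_ball (hϖ : IsUniformizer ϖ) (r : ℤ) : IsOpen (ball ϖ r : Set l) := by
  refine AddSubgroup.isOpen_of_mem_nhds (g := 0) _ ?_
  exact (IsValuativeTopology.hasBasis_nhds_zero' l).mem_iff.2
    ⟨v ϖ ^ r, zpow_ne_zero _ hϖ.val_ne_zero, fun x hx => mem_ball.2 (le_of_lt hx)⟩

end Lattices

/-! ### Lattices of matrices and congruence subgroups -/

section Matrices

variable {l : Type*} [Field l] [ValuativeRel l] [TopologicalSpace l]
  [IsNonarchimedeanLocalField l] {n : ℕ} {ϖ : l}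

local notation "v" => ValuativeRel.valuation l

/-- The lattice `ϖ^r M_n(𝒪_l)`. -/
def matBall (n : ℕ) (ϖ : l) (r : ℤ) : AddSubgroup (Matrix (Fin n) (Fin n) l) where
  carrier := {X | ∀ i j, X i j ∈ ball ϖ r}
  add_mem' := fun ha hb i j => add_mem (ha i j) (hb i j)
  zero_mem' := fun _ _ => zero_mem _
  neg_mem' := fun h i j => neg_mem (h i j)

theorem matBall_mono (hϖ : IsUniformizer ϖ) {r s : ℤ} (h : r ≤ s) :
    matBall n ϖ s ≤ matBall n ϖ r :=
  fun _ hx i j => ball_mono hϖ h (hx i j)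

theorem mul_mem_matBall (hϖ : IsUniformizer ϖ) {r s : ℤ} {X Y : Matrix (Fin n) (Fin n) l}
    (hX : X ∈ matBall n ϖ r) (hY : Y ∈ matBall n ϖ s) : X * Y ∈ matBall n ϖ (r + s) :=
  fun i j => by
    rw [Matrix.mul_apply]
    exact sum_mem fun k _ => mul_mem_ball hϖ (hX i k) (hY k j)

theorem one_mem_matBall : (1 : Matrix (Fin n) (Fin n) l) ∈ matBall n ϖ 0 := fun i j => by
  rw [Matrix.one_apply, mem_ball_zero]
  split_ifs <;> simp

theorem smul_mem_matBall (hϖ : IsUniformizer ϖ) {r s : ℤ} {θ : l}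
    {X : Matrix (Fin n) (Fin n) l} (hθ : θ ∈ ball ϖ r) (hX : X ∈ matBall n ϖ s) :
    θ • X ∈ matBall n ϖ (r + s) := fun i j => mul_mem_ball hϖ hθ (hX i j)

theorem isCompact_matBall (n : ℕ) (ϖ : l) (r : ℤ) :
    IsCompact (matBall n ϖ r : Set (Matrix (Fin n) (Fin n) l)) := by
  have h := isCompact_univ_pi (X := fun _ : Fin n => Fin n → l)
    (s := fun _ => Set.univ.pi fun _ => (ball ϖ r : Set l))
    fun _ => isCompact_univ_pi fun _ => isCompact_ball ϖ r
  have h' : (matBall n ϖ r : Set (Matrix (Fin n) (Fin n) l)) =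
      Set.univ.pi fun _ => Set.univ.pi fun _ => (ball ϖ r : Set l) := by
    exact Set.ext fun X => ⟨fun hX i _ j _ => hX i j, fun hX i j => hX i trivial j trivial⟩
  rw [h']
  exact h

theorem isOpen_matBall (hϖ : IsUniformizer ϖ) (n : ℕ) (r : ℤ) :
    IsOpen (matBall n ϖ r : Set (Matrix (Fin n) (Fin n) l)) := by
  have h : (matBall n ϖ r : Set (Matrix (Fin n) (Fin n) l)) =
      ⋂ (i : Fin n) (j : Fin n), (fun X : Matrix (Fin n) (Fin n) l => X i j) ⁻¹' (ball ϖ r) := by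
    ext X
    simp only [Set.mem_iInter]
    exact Iff.rfl
  rw [h]
  exact isOpen_iInter_of_finite fun i => isOpen_iInter_of_finite fun j =>
    (isOpen_ball hϖ r).preimage (continuous_id.matrix_elem i j)

theorem mem_maxCompactGL_iff {g : GL (Fin n) l} :
    g ∈ maxCompactGL l n ↔ (g : Matrix (Fin n) (Fin n) l) ∈ matBall n ϖ 0 ∧
      ((g⁻¹ : GL (Fin n) l) : Matrix (Fin n) (Fin n) l) ∈ matBall n ϖ 0 := by
  constructor
  · rintro ⟨h, rfl⟩
    exact ⟨fun i j => mem_ball_zero.2 (h i j).2, fun i j => mem_ball_zero.2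
      (((h⁻¹ : GL (Fin n) 𝒪[l]) : Matrix (Fin n) (Fin n) 𝒪[l]) i j).2⟩
  · rintro ⟨h1, h2⟩
    let A : Matrix (Fin n) (Fin n) 𝒪[l] := Matrix.of fun i j => ⟨g i j, mem_ball_zero.1 (h1 i j)⟩
    let B : Matrix (Fin n) (Fin n) 𝒪[l] := Matrix.of fun i j =>
      ⟨((g⁻¹ : GL (Fin n) l) : Matrix (Fin n) (Fin n) l) i j, mem_ball_zero.1 (h2 i j)⟩
    have hinj : Function.Injective ((Subring.subtype 𝒪[l]).mapMatrix (m := Fin n)) :=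
      Matrix.map_injective Subtype.val_injective
    have hA : (Subring.subtype 𝒪[l]).mapMatrix A = (g : Matrix (Fin n) (Fin n) l) := rfl
    have hB : (Subring.subtype 𝒪[l]).mapMatrix B =
      ((g⁻¹ : GL (Fin n) l) : Matrix (Fin n) (Fin n) l) := rfl
    refine ⟨⟨A, B, hinj ?_, hinj ?_⟩, Units.ext rfl⟩
    · rw [map_mul, map_one, hA, hB, ← Units.val_mul, mul_inv_cancel, Units.val_one]
    · rw [map_mul, map_one, hA, hB, ← Units.val_mul, inv_mul_cancel, Units.val_one]

/-- `1 + ϖ M_n(𝒪_l)` is contained in `GL_n(𝒪_l)`. -/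
theorem exists_mem_maxCompactGL_eq_one_add (hϖ : IsUniformizer ϖ)
    {X : Matrix (Fin n) (Fin n) l} (hX : X ∈ matBall n ϖ 1) :
    ∃ g ∈ maxCompactGL l n, (g : Matrix (Fin n) (Fin n) l) = 1 + X := by
  have hlt : ∀ i j, v (X i j) < 1 := fun i j =>
    lt_of_le_of_lt (mem_ball.1 (hX i j)) (by simpa using hϖ.val_lt_one)
  let Y : Matrix (Fin n) (Fin n) 𝒪[l] := Matrix.of fun i j => ⟨X i j, (hlt i j).le⟩
  have hres : (IsLocalRing.residue 𝒪[l]).mapMatrix Y = 0 := by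
    ext i j
    change IsLocalRing.residue 𝒪[l] (Y i j) = 0
    rw [IsLocalRing.residue_eq_zero_iff, IsLocalRing.mem_maximalIdeal, mem_nonunits_iff,
      isUnit_integers_iff]
    exact (hlt i j).ne
  have hdet : IsUnit (1 + Y).det := by
    refine isUnit_of_map_unit (IsLocalRing.residue 𝒪[l]) _ ?_
    rw [RingHom.map_det, map_add, hres, map_one, add_zero, Matrix.det_one]
    exact isUnit_one
  obtain ⟨u, hu⟩ := (Matrix.isUnit_iff_isUnit_det _).2 hdet
  refine ⟨_, ⟨u, rfl⟩, ?_⟩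
  change (Subring.subtype 𝒪[l]).mapMatrix (u : Matrix (Fin n) (Fin n) 𝒪[l]) = 1 + X
  rw [hu, map_add, map_one]
  rfl

/-- A set of invertible matrices is compact if it consists of those `g` for which `g` and `g⁻¹`
lie in given compact sets. -/
theorem isCompact_setOf_mem_and_inv_mem {A B : Set (Matrix (Fin n) (Fin n) l)} (hA : IsCompact A)
    (hB : IsCompact B) : IsCompact {g : GL (Fin n) l | (g : Matrix (Fin n) (Fin n) l) ∈ A ∧
      ((g⁻¹ : GL (Fin n) l) : Matrix (Fin n) (Fin n) l) ∈ B} := by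
  have h := (Units.isClosedEmbedding_embedProduct (α := Matrix (Fin n) (Fin n) l)).isCompact_preimage
    (hA.prod (hB.image MulOpposite.continuous_op))
  convert h using 1
  ext g
  simp only [Set.mem_preimage, Set.mem_prod, Units.embedProduct_apply, Set.mem_image,
    MulOpposite.op_inj, exists_eq_right]
  exact Iff.rfl

theorem exists_isUniformizer (l : Type*) [Field l] [ValuativeRel l] [TopologicalSpace l]
    [IsNonarchimedeanLocalField l] : ∃ ϖ : l, IsUniformizer ϖ := by
  obtain ⟨p, hp⟩ := IsDiscreteValuationRing.exists_irreducible 𝒪[l]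
  exact ⟨p, p, hp, rfl⟩

theorem isCompact_maxCompactGL : IsCompact (maxCompactGL l n : Set (GL (Fin n) l)) := by
  obtain ⟨ϖ, -⟩ := exists_isUniformizer l
  convert isCompact_setOf_mem_and_inv_mem (isCompact_matBall n ϖ 0) (isCompact_matBall n ϖ 0)
    using 1
  ext g
  exact mem_maxCompactGL_iff

end Matrices

/-! ### The Iwasawa decomposition of `GL_n` -/

section Iwasawa

variable {l : Type*} [Field l] [ValuativeRel l] [TopologicalSpace l]
  [IsNonarchimedeanLocalField l] {n : ℕ}

local notation "v" => ValuativeRel.valuation l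

/-- One row of the column reduction: if all rows below row `r` are already reduced, integral column
operations among the columns `≤ r` move an entry of maximal valuation in the row `r` to the
diagonal and clear the entries to its left. -/
theorem exists_maxCompactGL_reduce_row (h : GL (Fin n) l) (r : Fin n)
    (hr : ∀ i, r < i → ∀ j < i, h i j = 0) :
    ∃ κ ∈ maxCompactGL l n, ∀ i, r ≤ i → ∀ j < i, (h * κ) i j = 0 := by
  classical
  obtain ⟨ϖ, -⟩ := exists_isUniformizer l
  have hex : ∃ c, c ≤ r ∧ h r c ≠ 0 := by
    by_contra! hcon
    have hdet : (h : Matrix (Fin n) (Fin n) l).det ≠ 0 :=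
      (Matrix.isUnits_det_units h).ne_zero
    refine hdet ?_
    rw [Matrix.twoBlockTriangular_det _ (fun i => i ≤ r)
      (fun i hi j hj => hr i (not_le.1 hi) j (lt_of_le_of_lt hj (not_le.1 hi)))]
    rw [Matrix.det_eq_zero_of_row_eq_zero ⟨r, le_refl r⟩ (fun j => hcon j.1 j.2), zero_mul]
  obtain ⟨c, hc, hmax⟩ := Finset.exists_max_image (Finset.univ.filter fun c => c ≤ r)
    (fun c => v (h r c)) ⟨r, by simp⟩
  simp only [Finset.mem_filter, Finset.mem_univ, true_and] at hc hmax
  have hc0 : h r c ≠ 0 := by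
    obtain ⟨c', hc', h0⟩ := hex
    intro hz
    have := hmax c' hc'
    rw [hz, map_zero, le_zero_iff, Valuation.zero_iff] at this
    exact h0 this
  let P : Matrix (Fin n) (Fin n) l := Matrix.swap l c r
  have hPP : P * P = 1 := Matrix.swap_mul_self c r
  have hP : ∀ (X : Matrix (Fin n) (Fin n) l) i j, (X * P) i j = X i (Equiv.swap c r j) := by
    intro X i j
    have := congrFun (Matrix.vecMul_swap (R := l) c r (X i)) j
    exact this
  have hPint : P ∈ matBall n ϖ 0 := fun i j => by
    have := hP 1 i j
    rw [one_mul] at this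
    rw [this]
    exact one_mem_matBall _ _
  let U : Matrix (Fin n) (Fin n) l := Matrix.of fun i j =>
    if i = r ∧ j < r then -(h r (Equiv.swap c r j) / h r c) else 0
  have hUU : U * U = 0 := by
    ext i j
    rw [Matrix.mul_apply]
    refine Finset.sum_eq_zero fun k _ => ?_
    simp only [U, Matrix.of_apply]
    split_ifs with h1 h2
    · exact absurd h1.2 (by rw [h2.1]; exact lt_irrefl r)
    all_goals simp
  have hswap : ∀ j, j < r → Equiv.swap c r j ≤ r := fun j hj => by
    rcases eq_or_ne j c with rfl | hjc
    · simp
    · rw [Equiv.swap_apply_of_ne_of_ne hjc hj.ne]; exact hj.le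
  have hUint : U ∈ matBall n ϖ 0 := fun i j => by
    simp only [U, Matrix.of_apply]
    split_ifs with h1
    · rw [mem_ball_zero, Valuation.map_neg, map_div₀]
      exact div_le_one_of_le₀ (hmax _ (hswap j h1.2)) zero_le
    · exact zero_mem _
  let κ₁ : GL (Fin n) l := ⟨P, P, hPP, hPP⟩
  let κ₂ : GL (Fin n) l := ⟨1 + U, 1 - U, by
    rw [mul_sub, mul_one, add_mul, one_mul, hUU]; abel, by
    rw [mul_add, mul_one, sub_mul, one_mul, hUU]; abel⟩
  refine ⟨κ₁ * κ₂, mul_mem (mem_maxCompactGL_iff.2 ⟨hPint, hPint⟩)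
    (mem_maxCompactGL_iff.2 ⟨add_mem one_mem_matBall hUint, sub_mem one_mem_matBall hUint⟩), ?_⟩
  intro i hi j hj
  have hval : (h * (κ₁ * κ₂)) i j = h i (Equiv.swap c r j) + h i c * U r j := by
    change ((h : Matrix (Fin n) (Fin n) l) * (P * (1 + U))) i j = _
    rw [← mul_assoc, mul_add, mul_one, Matrix.add_apply, hP, Matrix.mul_apply,
      Finset.sum_eq_single r]
    · rw [hP, Equiv.swap_apply_right]
    · intro k _ hk
      simp [U, hk]
    · simp
  rw [hval]
  rcases hi.eq_or_lt with rfl | hlt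
  · simp only [U, Matrix.of_apply, hj, and_self, if_true]
    field_simp
    ring
  · rw [hr i hlt c (lt_of_le_of_lt hc hlt), zero_mul, add_zero]
    rcases eq_or_ne j c with rfl | hjc
    · rw [Equiv.swap_apply_left]; exact hr i hlt r hlt
    · rcases eq_or_ne j r with rfl | hjr
      · rw [Equiv.swap_apply_right]; exact hr i hlt c (lt_of_le_of_lt hc hlt)
      · rw [Equiv.swap_apply_of_ne_of_ne hjc hjr]; exact hr i hlt j hj

/-- The Iwasawa decomposition `GL_n(l) = P_l K_l`. -/
theorem exists_borelGL_mul_maxCompactGL (g : GL (Fin n) l) :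
    ∃ p ∈ borelGL l n, ∃ κ ∈ maxCompactGL l n, g = p * κ := by
  have key : ∀ m : ℕ, ∃ κ ∈ maxCompactGL l n, ∀ i : Fin n, n ≤ i + m → ∀ j < i,
      (g * κ) i j = 0 := by
    intro m
    induction m with
    | zero => exact ⟨1, one_mem _, fun i hi => absurd i.2 (by omega)⟩
    | succ m ih =>
      obtain ⟨κ, hκ, h⟩ := ih
      by_cases hm : m < n
      · obtain ⟨κ', hκ', h'⟩ := exists_maxCompactGL_reduce_row (g * κ) ⟨n - 1 - m, by omega⟩
          fun i hi => h i (by have := Fin.lt_def.1 hi; simp only at this; omega)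
        refine ⟨κ * κ', mul_mem hκ hκ', fun i hi j hj => ?_⟩
        rw [← mul_assoc]
        exact h' i (by rw [Fin.le_def]; simp only; omega) j hj
      · exact ⟨κ, hκ, fun i hi => h i (by omega)⟩
  obtain ⟨κ, hκ, h⟩ := key n
  exact ⟨g * κ, fun i j hij => h i (by omega) j hij, κ⁻¹, inv_mem hκ, by simp⟩

/-- A `K_l`-fixed vector of a principal series of `GL_n(l)` is determined by its value at `1`. -/
theorem exists_smul_of_fixed_inducedRep (χ : borelGL l n →* ℂˣ)
    (φ ψ : inducedSpace (borelGL l n) χ)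
    (hφ : ∀ κ ∈ maxCompactGL l n, inducedRep (borelGL l n) χ κ φ = φ)
    (hψ : ∀ κ ∈ maxCompactGL l n, inducedRep (borelGL l n) χ κ ψ = ψ) (h0 : φ ≠ 0) :
    ∃ z : ℂ, ψ = z • φ := by
  have key : ∀ f : inducedSpace (borelGL l n) χ,
      (∀ κ ∈ maxCompactGL l n, inducedRep (borelGL l n) χ κ f = f) →
      ∀ (p : borelGL l n) (κ), κ ∈ maxCompactGL l n →
        f.1 (p * κ) = sqrtModulus (borelGL l n) p * (χ p : ℂ) * f.1 1 := by
    intro f hf p κ hκ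
    have h1 : f.1 (p * κ) = f.1 p := congrFun (congrArg Subtype.val (hf κ hκ)) p
    rw [h1, ← f.2.1 p 1, mul_one]
  have h1 : φ.1 1 ≠ 0 := fun hz => h0 <| Subtype.ext <| funext fun g => by
    obtain ⟨p, hp, κ, hκ, rfl⟩ := exists_borelGL_mul_maxCompactGL g
    rw [key φ hφ ⟨p, hp⟩ κ hκ, hz, mul_zero]
    rfl
  refine ⟨ψ.1 1 / φ.1 1, Subtype.ext <| funext fun g => ?_⟩
  obtain ⟨p, hp, κ, hκ, rfl⟩ := exists_borelGL_mul_maxCompactGL g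
  change ψ.1 (p * κ) = ψ.1 1 / φ.1 1 * φ.1 (p * κ)
  rw [key φ hφ ⟨p, hp⟩ κ hκ, key ψ hψ ⟨p, hp⟩ κ hκ]
  field_simp

end Iwasawa

/-! ### The modular character and indices of compact open subgroups -/

section Modular

open MeasureTheory MeasureTheory.Measure

@[to_additive relIndex_ne_zero_of_isOpen_of_isCompact_add]
theorem relIndex_ne_zero_of_isOpen_of_isCompact {G : Type*} [Group G] [TopologicalSpace G]
    [IsTopologicalGroup G] {H' H : Subgroup G} (hH' : IsOpen (H' : Set G))
    (hH : IsCompact (H : Set G)) : H'.relIndex H ≠ 0 := by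
  have : CompactSpace H := isCompact_iff_compactSpace.1 hH
  have : Finite (H ⧸ H'.subgroupOf H) :=
    Subgroup.quotient_finite_of_isOpen _ (hH'.preimage continuous_subtype_val)
  exact Subgroup.index_ne_zero_of_finite

variable {G : Type*} [Group G] [TopologicalSpace G] [IsTopologicalGroup G]

theorem measure_eq_relIndex_mul [MeasurableSpace G] [BorelSpace G] (μ : Measure G)
    [IsMulLeftInvariant μ] {H' H : Subgroup G} (hle : H' ≤ H) (hH' : IsOpen (H' : Set G))
    (hH : IsCompact (H : Set G)) : μ H = H'.relIndex H * μ H' := by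
  have hHo : IsOpen (H : Set G) := Subgroup.isOpen_mono hle hH'
  have hemb : MeasurableEmbedding H.subtype := MeasurableEmbedding.subtype_coe hHo.measurableSet
  have : IsMulLeftInvariant (μ.comap H.subtype) := IsMulLeftInvariant.comap μ hemb
  have : (H'.subgroupOf H).FiniteIndex :=
    ⟨relIndex_ne_zero_of_isOpen_of_isCompact hH' hH⟩
  have h := (H'.subgroupOf H).index_mul_measure
    (hH'.preimage continuous_subtype_val).measurableSet (μ.comap H.subtype)
  rw [hemb.comap_apply, hemb.comap_apply] at h
  have h1 : H.subtype '' (Set.univ) = (H : Set G) := by simp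
  have h2 : H.subtype '' ((H'.subgroupOf H : Subgroup H) : Set H) = (H' : Set G) := by
    ext x
    simp only [Set.mem_image, SetLike.mem_coe, Subgroup.mem_subgroupOf, Subgroup.coe_subtype]
    exact ⟨fun ⟨y, hy, hxy⟩ => hxy ▸ hy, fun hx => ⟨⟨x, hle hx⟩, hx, rfl⟩⟩
  rw [h1, h2] at h
  exact h.symm

variable [LocallyCompactSpace G]

/-- `δ(g) [H : Γ] = [gHg⁻¹ : Γ]` for compact open subgroups `Γ ⊆ H ∩ gHg⁻¹`. -/
theorem modularCharacter_mul_relIndex {Γ H H' : Subgroup G} (g : G)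
    (hΓ : IsOpen (Γ : Set G)) (hH : IsCompact (H : Set G)) (hH'c : IsCompact (H' : Set G))
    (hle : Γ ≤ H) (hle' : Γ ≤ H') (hH' : ∀ x, x ∈ H' ↔ g⁻¹ * x * g ∈ H) :
    modularCharacter g * (Γ.relIndex H : NNReal) = (Γ.relIndex H' : NNReal) := by
  borelize G
  let μ : Measure G := haar
  have hHo : IsOpen (H : Set G) := Subgroup.isOpen_mono hle hΓ
  have hHcl : IsClosed (H : Set G) := Subgroup.isClosed_of_isOpen H hHo
  have h1 : μ.map (· * g) (H : Set G) = modularCharacter g • μ H := by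
    change _ = modularCharacterFun g • μ H
    rw [modularCharacterFun_eq_haarScalarFactor μ g]
    exact measure_isMulInvariant_eq_smul_of_isCompact_closure _ _ (by rwa [hHcl.closure_eq])
  have h2 : μ.map (· * g) (H : Set G) = μ H' := by
    rw [map_apply (measurable_mul_const g) hHo.measurableSet, ← measure_preimage_mul μ g⁻¹]
    congr 1
    ext x
    exact (hH' x).symm
  rw [h2, measure_eq_relIndex_mul μ hle' hΓ hH'c, measure_eq_relIndex_mul μ hle hΓ hH] at h1
  have hpos : μ Γ ≠ 0 := (hΓ.measure_pos μ ⟨1, one_mem Γ⟩).ne'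
  have hfin : μ Γ ≠ ⊤ := ((measure_mono hle).trans_lt hH.measure_lt_top).ne
  rw [ENNReal.smul_def, smul_eq_mul, ← mul_assoc] at h1
  have h3 := (ENNReal.mul_left_inj hpos hfin).1 h1
  exact_mod_cast h3.symm

end Modular

/-! ### Indices of lattices -/

section Index

/-- A map inducing a bijection of coset spaces preserves the relative index. -/
theorem relIndex_eq_of_surjOn {G A : Type*} [Group G] [AddCommGroup A] {H' H : Subgroup G}
    {L' L : AddSubgroup A} (D : G → A) (hmaps : ∀ g ∈ H, D g ∈ L)
    (hsurj : ∀ x ∈ L, ∃ g ∈ H, D g = x)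
    (hiff : ∀ g ∈ H, ∀ h ∈ H, g⁻¹ * h ∈ H' ↔ -D g + D h ∈ L') :
    H'.relIndex H = L'.relIndex L := by
  let D' : H → L := fun g => ⟨D g, hmaps g g.2⟩
  have hD' : ∀ g h : H, QuotientGroup.leftRel (H'.subgroupOf H) g h ↔
      QuotientAddGroup.leftRel (L'.addSubgroupOf L) (D' g) (D' h) := fun g h => by
    rw [QuotientGroup.leftRel_apply, QuotientAddGroup.leftRel_apply]
    exact hiff g g.2 h h.2
  refine Nat.card_congr (Equiv.ofBijective
    (Quotient.map D' fun g h hgh => (hD' g h).1 hgh) ⟨?_, ?_⟩)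
  · rintro ⟨g⟩ ⟨h⟩ hgh
    exact Quotient.sound ((hD' g h).2 (Quotient.exact hgh))
  · rintro ⟨x⟩
    obtain ⟨g, hg, hgx⟩ := hsurj x x.2
    refine ⟨Quotient.mk _ ⟨g, hg⟩, ?_⟩
    exact congrArg (Quotient.mk _) (Subtype.ext hgx)

theorem relIndex_pi {ι A : Type*} [Fintype ι] [AddCommGroup A] (L' L : ι → AddSubgroup A) :
    (AddSubgroup.pi Set.univ L').relIndex (AddSubgroup.pi Set.univ L) =
      ∏ i, (L' i).relIndex (L i) := by
  let f : (∀ i, L i) →+ (ι → A) := AddMonoidHom.mk' (fun x i => x i) fun _ _ => rfl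
  have hrange : f.range = AddSubgroup.pi Set.univ L := by
    ext x
    refine ⟨?_, fun hx => ⟨fun i => ⟨x i, hx i trivial⟩, rfl⟩⟩
    rintro ⟨y, rfl⟩ i -
    exact (y i).2
  rw [← hrange, ← AddSubgroup.index_comap]
  have : AddSubgroup.comap f (AddSubgroup.pi Set.univ L') =
      AddSubgroup.pi Set.univ fun i => (L' i).addSubgroupOf (L i) := rfl
  rw [this]
  simp_rw [AddSubgroup.relIndex, AddSubgroup.index, ← Nat.card_pi]
  refine Nat.card_congr
    ((Quotient.congrRight (fun x y => ?_)).trans (Setoid.piQuotientEquiv _).symm)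
  rw [QuotientAddGroup.leftRel_pi]

variable {l : Type*} [Field l] [ValuativeRel l] [TopologicalSpace l]
  [IsNonarchimedeanLocalField l] {ϖ : l}

/-- The index of `ϖ(S ∩ 𝒪_l)` in `S ∩ 𝒪_l`, for a subgroup `S` of `l` with `ϖS = S`. -/
noncomputable def latIndex (ϖ : l) (S : AddSubgroup l) : ℕ := (S ⊓ ball ϖ 1).relIndex (S ⊓ ball ϖ 0)

theorem latIndex_ne_zero (hϖ : IsUniformizer ϖ) (S : AddSubgroup l) : latIndex ϖ S ≠ 0 := by
  have h : (ball ϖ 1).relIndex (ball ϖ 0) ≠ 0 :=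
    relIndex_ne_zero_of_isOpen_of_isCompact_add (isOpen_ball hϖ 1) (isCompact_ball ϖ 0)
  intro h0
  refine h (AddSubgroup.relIndex_eq_zero_of_le_right (inf_le_right : S ⊓ ball ϖ 0 ≤ _) ?_)
  rw [← AddSubgroup.inf_relIndex_right, ← inf_assoc, inf_comm (ball ϖ 1) S, inf_assoc,
    inf_eq_left.2 (ball_mono hϖ zero_le_one)]
  exact h0

theorem zpow_mul_mem_of_stable (hϖ : ϖ ≠ 0) {S : AddSubgroup l} (hS : ∀ x, ϖ * x ∈ S ↔ x ∈ S)
    (m : ℤ) (x : l) : ϖ ^ m * x ∈ S ↔ x ∈ S := by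
  induction m with
  | zero => simp
  | succ m ih => rw [add_comm, zpow_one_add₀ hϖ, mul_assoc, hS, ih]
  | pred m ih => rw [← hS, ← mul_assoc, ← zpow_one_add₀ hϖ,
      show (1 : ℤ) + (-m - 1) = -m by ring, ih]

theorem relIndex_inf_ball (hϖ : IsUniformizer ϖ) {S : AddSubgroup l}
    (hS : ∀ x, ϖ * x ∈ S ↔ x ∈ S) (r : ℤ) (m : ℕ) :
    (S ⊓ ball ϖ (r + m)).relIndex (S ⊓ ball ϖ r) = latIndex ϖ S ^ m := by
  have hmap : ∀ r s : ℤ, (S ⊓ ball ϖ s).map (AddMonoidHom.mulLeft (ϖ ^ r)) = S ⊓ ball ϖ (s + r) := by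
    intro r s
    ext x
    constructor
    · rintro ⟨y, ⟨hy1, hy2⟩, rfl⟩
      exact ⟨(zpow_mul_mem_of_stable hϖ.ne_zero hS r y).2 hy1,
        (zpow_mul_mem_ball hϖ).2 (by simpa using hy2)⟩
    · rintro ⟨hx1, hx2⟩
      refine ⟨ϖ ^ (-r) * x, ⟨(zpow_mul_mem_of_stable hϖ.ne_zero hS _ x).2 hx1,
        (zpow_mul_mem_ball hϖ).2 (by simpa using hx2)⟩, ?_⟩
      change ϖ ^ r * (ϖ ^ (-r) * x) = x
      rw [← mul_assoc, ← zpow_add₀ hϖ.ne_zero, add_neg_cancel, zpow_zero, one_mul]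
  have hstep : ∀ r : ℤ, (S ⊓ ball ϖ (r + 1)).relIndex (S ⊓ ball ϖ r) = latIndex ϖ S := fun r => by
    have hinj : Function.Injective (AddMonoidHom.mulLeft (ϖ ^ r)) :=
      mul_right_injective₀ (zpow_ne_zero _ hϖ.ne_zero)
    rw [latIndex, ← AddSubgroup.relIndex_map_map_of_injective (S ⊓ ball ϖ 1) _ hinj, hmap, hmap,
      zero_add, add_comm]
  induction m with
  | zero => simp
  | succ m ih =>
    rw [show r + ((m + 1 : ℕ) : ℤ) = r + m + 1 by push_cast; ring,
      ← AddSubgroup.relIndex_mul_relIndex (K := S ⊓ ball ϖ (r + m)), ih, pow_succ', hstep]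
    · exact inf_le_inf_left _ (ball_mono hϖ (by omega))
    · exact inf_le_inf_left _ (ball_mono hϖ (by omega))

end Index

/-! ### Congruence subgroups and the Cayley transform -/

section Cayley

variable {l : Type*} [Field l] [ValuativeRel l] [TopologicalSpace l]
  [IsNonarchimedeanLocalField l] {n : ℕ} {ϖ θ : l} {s₀ : ℕ}

local notation "v" => ValuativeRel.valuation l
local notation "Mat" => Matrix (Fin n) (Fin n) l

theorem mul_mem_matBall_iff (hϖ : IsUniformizer ϖ) {κ : GL (Fin n) l} (hκ : κ ∈ maxCompactGL l n)
    {X : Mat} {r : ℤ} : (κ : Mat) * X ∈ matBall n ϖ r ↔ X ∈ matBall n ϖ r := by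
  obtain ⟨h1, h2⟩ := (mem_maxCompactGL_iff (ϖ := ϖ)).1 hκ
  constructor
  · intro h
    have := mul_mem_matBall hϖ h2 h
    rwa [← mul_assoc, ← Units.val_mul, inv_mul_cancel, Units.val_one, one_mul, zero_add] at this
  · intro h
    simpa using mul_mem_matBall hϖ h1 h

theorem matBall_mul_mem_iff (hϖ : IsUniformizer ϖ) {κ : GL (Fin n) l} (hκ : κ ∈ maxCompactGL l n)
    {X : Mat} {r : ℤ} : X * (κ : Mat) ∈ matBall n ϖ r ↔ X ∈ matBall n ϖ r := by
  obtain ⟨h1, h2⟩ := (mem_maxCompactGL_iff (ϖ := ϖ)).1 hκ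
  constructor
  · intro h
    have := mul_mem_matBall hϖ h h2
    rwa [mul_assoc, ← Units.val_mul, mul_inv_cancel, Units.val_one, mul_one, add_zero] at this
  · intro h
    simpa using mul_mem_matBall hϖ h h1

/-- The group of the `g ∈ GL_n(𝒪_l)` with `g ≡ 1` and `g⁻¹ ≡ 1` modulo `ϖ^s`. -/
def congruenceSubgroup (hϖ : IsUniformizer ϖ) (s : ℕ) : Subgroup (GL (Fin n) l) where
  carrier := {g | (g : Mat) - 1 ∈ matBall n ϖ s ∧ ((g⁻¹ : GL (Fin n) l) : Mat) - 1 ∈ matBall n ϖ s}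
  one_mem' := by simp [zero_mem]
  inv_mem' := fun {g} hg => ⟨hg.2, by rw [inv_inv]; exact hg.1⟩
  mul_mem' := by
    have key : ∀ X Y : Mat, X - 1 ∈ matBall n ϖ s → Y - 1 ∈ matBall n ϖ s →
        X * Y - 1 ∈ matBall n ϖ s := fun X Y hX hY => by
      have h : X * Y - 1 = (X - 1) * (Y - 1) + (X - 1) + (Y - 1) := by noncomm_ring
      rw [h]
      exact add_mem (add_mem (matBall_mono hϖ (by omega) (mul_mem_matBall hϖ hX hY)) hX) hY
    intro g h hg hh
    refine ⟨?_, ?_⟩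
    · rw [Units.val_mul]; exact key _ _ hg.1 hh.1
    · rw [mul_inv_rev, Units.val_mul]; exact key _ _ hh.2 hg.2

theorem congruenceSubgroup_mono (hϖ : IsUniformizer ϖ) {r s : ℕ} (h : r ≤ s) :
    congruenceSubgroup (n := n) hϖ s ≤ congruenceSubgroup (n := n) hϖ r := fun _ hg =>
  ⟨matBall_mono hϖ (by exact_mod_cast h) hg.1, matBall_mono hϖ (by exact_mod_cast h) hg.2⟩

theorem congruenceSubgroup_le (hϖ : IsUniformizer ϖ) (s : ℕ) :
    congruenceSubgroup (n := n) hϖ s ≤ maxCompactGL l n := fun g hg => by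
  have key : ∀ X : Mat, X - 1 ∈ matBall n ϖ s → X ∈ matBall n ϖ 0 := fun X hX => by
    have := add_mem (matBall_mono hϖ (by omega) hX) (one_mem_matBall (ϖ := ϖ))
    rwa [sub_add_cancel] at this
  exact mem_maxCompactGL_iff.2 ⟨key _ hg.1, key _ hg.2⟩

theorem mem_congruenceSubgroup_iff (hϖ : IsUniformizer ϖ) {s : ℕ} (hs : 1 ≤ s)
    {g : GL (Fin n) l} : g ∈ congruenceSubgroup (n := n) hϖ s ↔ (g : Mat) - 1 ∈ matBall n ϖ s := by
  refine ⟨fun h => h.1, fun h => ⟨h, ?_⟩⟩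
  obtain ⟨κ, hκ, hκg⟩ := exists_mem_maxCompactGL_eq_one_add hϖ
    (matBall_mono hϖ (by exact_mod_cast hs) h)
  have hg : κ = g := Units.ext (by rw [hκg]; abel)
  subst hg
  rw [← mul_mem_matBall_iff hϖ hκ, mul_sub, ← Units.val_mul, mul_inv_cancel, mul_one,
    ← neg_mem_iff, neg_sub]
  exact h

theorem isOpen_congruenceSubgroup (hϖ : IsUniformizer ϖ) (s : ℕ) :
    IsOpen (congruenceSubgroup (n := n) hϖ s : Set (GL (Fin n) l)) :=
  ((isOpen_matBall hϖ n s).preimage (Units.continuous_val.sub continuous_const)).inter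
    ((isOpen_matBall hϖ n s).preimage (Units.continuous_coe_inv.sub continuous_const))

theorem isCompact_congruenceSubgroup (hϖ : IsUniformizer ϖ) (s : ℕ) :
    IsCompact (congruenceSubgroup (n := n) hϖ s : Set (GL (Fin n) l)) := by
  have h : IsCompact ((fun X : Mat => X + 1) '' (matBall n ϖ s : Set Mat)) :=
    (isCompact_matBall n ϖ s).image (continuous_id.add continuous_const)
  have h' : ∀ X : Mat, X ∈ ((fun X : Mat => X + 1) '' (matBall n ϖ s : Set Mat)) ↔
      X - 1 ∈ matBall n ϖ s := fun X =>
    ⟨fun ⟨Y, hY, hYX⟩ => by rw [← hYX, add_sub_cancel_right]; exact hY,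
      fun hX => ⟨X - 1, hX, sub_add_cancel _ _⟩⟩
  convert isCompact_setOf_mem_and_inv_mem h h using 1
  ext g
  exact and_congr (h' _).symm (h' _).symm

/-- The inverse of the map `X ↦ (1 - θX)⁻¹ (1 + (1 - θ)X)`. When `θ + c(θ) = 1` for the conjugation
`c`, the latter takes antihermitian to unitary matrices, in every characteristic; for `θ = 1/2` it
is the Cayley transform. -/
noncomputable def cayley (θ : l) (g : Mat) : Mat := (g - 1) * (1 + θ • (g - 1))⁻¹

theorem cayley_eq {g : Mat} {κ : GL (Fin n) l} (hκ : (κ : Mat) = 1 + θ • (g - 1)) :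
    cayley θ g = (g - 1) * ((κ⁻¹ : GL (Fin n) l) : Mat) := by
  rw [cayley, ← hκ, Matrix.coe_units_inv]

theorem cayley_mul_eq {g : Mat} (hg : IsUnit (1 + θ • (g - 1))) :
    cayley θ g * (1 + θ • (g - 1)) = g - 1 := by
  obtain ⟨κ, hκ⟩ := hg
  rw [cayley_eq hκ, ← hκ, mul_assoc, ← Units.val_mul, inv_mul_cancel, Units.val_one, mul_one]

theorem exists_one_add_smul (hϖ : IsUniformizer ϖ) (hθ : θ ∈ ball ϖ (1 - s₀)) {X : Mat}
    (hX : X ∈ matBall n ϖ s₀) :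
    ∃ κ ∈ maxCompactGL l n, (κ : Mat) = 1 + θ • X :=
  exists_mem_maxCompactGL_eq_one_add hϖ (by simpa using smul_mem_matBall hϖ hθ hX)

theorem cayley_mem_matBall_iff (hϖ : IsUniformizer ϖ) (hθ : θ ∈ ball ϖ (1 - s₀)) {g : Mat}
    (hg : g - 1 ∈ matBall n ϖ s₀) {r : ℤ} :
    cayley θ g ∈ matBall n ϖ r ↔ g - 1 ∈ matBall n ϖ r := by
  obtain ⟨κ, hκ, hκg⟩ := exists_one_add_smul hϖ hθ hg
  rw [cayley_eq hκg, matBall_mul_mem_iff hϖ (inv_mem hκ)]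

/-- If the Cayley transform of `g` is small then so is `g - 1`, wherever it is defined. -/
theorem sub_one_mem_matBall_of_cayley (hϖ : IsUniformizer ϖ) (hθ : θ ∈ ball ϖ (1 - s₀)) {g : Mat}
    (hg : IsUnit (1 + θ • (g - 1))) {s : ℕ} (hs : s₀ ≤ s) (h : cayley θ g ∈ matBall n ϖ s) :
    g - 1 ∈ matBall n ϖ s := by
  have h1 := cayley_mul_eq hg
  obtain ⟨κ, hκ, hκg⟩ := exists_one_add_smul (n := n) hϖ hθ
    (neg_mem (matBall_mono hϖ (by exact_mod_cast hs) h))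
  -- `(1 - θX)(1 + θY) = 1` for `X` the transform and `Y = g - 1`.
  have h2 : (κ : Mat) * (1 + θ • (g - 1)) = 1 := by
    rw [hκg, smul_neg, add_mul, neg_mul, smul_mul_assoc, h1]
    simp
  have h3 : (κ : Mat) * (g - 1) = cayley θ g := by
    rw [hκg, smul_neg, add_mul, neg_mul, smul_mul_assoc, one_mul]
    nth_rewrite 1 [← h1]
    rw [mul_add, mul_one, mul_smul_comm]
    abel
  rwa [← mul_mem_matBall_iff hϖ hκ, h3]

theorem cayley_sub_cayley_mem_iff (hϖ : IsUniformizer ϖ) (hθ : θ ∈ ball ϖ (1 - s₀))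
    {g h : GL (Fin n) l} (hg : g ∈ congruenceSubgroup (n := n) hϖ s₀)
    (hh : h ∈ congruenceSubgroup (n := n) hϖ s₀) {r : ℤ} :
    -cayley θ (g : Mat) + cayley θ (h : Mat) ∈ matBall n ϖ r ↔
      ((g⁻¹ * h : GL (Fin n) l) : Mat) - 1 ∈ matBall n ϖ r := by
  obtain ⟨α, hα, hαg⟩ := exists_one_add_smul hϖ hθ hg.1
  obtain ⟨β, hβ, hβh⟩ := exists_one_add_smul hϖ hθ hh.1
  have h1 : (β : Mat) * (-cayley θ (g : Mat) + cayley θ (h : Mat)) * α = (h : Mat) - g := by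
    have h2 : cayley θ (g : Mat) * α = g - 1 := by
      rw [hαg]; exact cayley_mul_eq ⟨α, hαg⟩
    have h3 : (β : Mat) * cayley θ (h : Mat) = h - 1 := by
      have hcomm : (β : Mat) * ((h : Mat) - 1) = ((h : Mat) - 1) * β := by
        rw [hβh, add_mul, mul_add, smul_mul_assoc, mul_smul_comm, one_mul, mul_one]
      rw [cayley_eq hβh, ← mul_assoc, hcomm, mul_assoc, ← Units.val_mul, mul_inv_cancel,
        Units.val_one, mul_one]
    calc (β : Mat) * (-cayley θ (g : Mat) + cayley θ (h : Mat)) * α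
        = (β : Mat) * cayley θ (h : Mat) * α - β * (cayley θ (g : Mat) * α) := by noncomm_ring
      _ = (h : Mat) - g := by
        rw [h2, h3, hαg, hβh, add_mul, mul_add, smul_mul_assoc, mul_smul_comm]
        noncomm_ring
  rw [← mul_mem_matBall_iff hϖ hβ, ← matBall_mul_mem_iff hϖ hα, h1,
    ← mul_mem_matBall_iff hϖ (congruenceSubgroup_le hϖ s₀ hg) (X := _ - 1), mul_sub,
    ← Units.val_mul, mul_inv_cancel_left, mul_one]

theorem cayley_eq_of_eq (hϖ : IsUniformizer ϖ) (hθ : θ ∈ ball ϖ (1 - s₀)) {X : Mat}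
    (hX : X ∈ matBall n ϖ s₀) {g : Mat} (hg : g = 1 + (1 - θ • X)⁻¹ * X) :
    cayley θ g = X ∧ g - 1 ∈ matBall n ϖ s₀ := by
  obtain ⟨κ, hκ, hκX⟩ := exists_one_add_smul hϖ hθ (neg_mem hX)
  rw [smul_neg, ← sub_eq_add_neg] at hκX
  have h1 : g - 1 = ((κ⁻¹ : GL (Fin n) l) : Mat) * X := by
    rw [hg, ← hκX, Matrix.coe_units_inv, add_sub_cancel_left]
  have h2 : 1 + θ • (g - 1) = ((κ⁻¹ : GL (Fin n) l) : Mat) := by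
    rw [h1, ← mul_smul_comm]
    calc (1 : Mat) + ((κ⁻¹ : GL (Fin n) l) : Mat) * (θ • X)
        = ((κ⁻¹ : GL (Fin n) l) : Mat) * (κ + θ • X) := by
          rw [mul_add, ← Units.val_mul, inv_mul_cancel, Units.val_one]
      _ = _ := by rw [hκX, sub_add_cancel, mul_one]
  refine ⟨?_, ?_⟩
  · have hcomm : ((κ⁻¹ : GL (Fin n) l) : Mat) * X = X * ((κ⁻¹ : GL (Fin n) l) : Mat) := by
      have h3 : Commute (κ : Mat) X := by
        rw [hκX]
        exact (Commute.one_left X).sub_left ((Commute.refl X).smul_left θ)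
      exact h3.units_inv_left
    rw [cayley_eq h2.symm, h1, inv_inv, hcomm, mul_assoc, ← Units.val_mul, inv_mul_cancel,
      Units.val_one, mul_one]
  · rw [h1, mul_mem_matBall_iff hϖ (inv_mem hκ)]
    exact hX

theorem cayley_conj (a : GL (Fin n) l) (g : Mat) :
    cayley θ (((a⁻¹ : GL (Fin n) l) : Mat) * g * (a : Mat)) =
      ((a⁻¹ : GL (Fin n) l) : Mat) * cayley θ g * (a : Mat) := by
  have ha : (a : Mat) * ((a⁻¹ : GL (Fin n) l) : Mat) = 1 := by
    rw [← Units.val_mul, mul_inv_cancel, Units.val_one]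
  have ha' : ((a⁻¹ : GL (Fin n) l) : Mat) * (a : Mat) = 1 := by
    rw [← Units.val_mul, inv_mul_cancel, Units.val_one]
  have h1 : ((a⁻¹ : GL (Fin n) l) : Mat) * g * a - 1 =
      ((a⁻¹ : GL (Fin n) l) : Mat) * (g - 1) * (a : Mat) := by
    rw [mul_sub, sub_mul, mul_one, ha']
  have h2 : 1 + θ • (((a⁻¹ : GL (Fin n) l) : Mat) * (g - 1) * (a : Mat)) =
      ((a⁻¹ : GL (Fin n) l) : Mat) * (1 + θ • (g - 1)) * (a : Mat) := by
    rw [mul_add, add_mul, mul_one, ha', mul_smul_comm, smul_mul_assoc]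
  rw [cayley, cayley, h1, h2, Matrix.mul_inv_rev, Matrix.mul_inv_rev, ← Matrix.coe_units_inv,
    ← Matrix.coe_units_inv, inv_inv]
  simp only [mul_assoc]
  rw [← mul_assoc (a : Mat) _ (_ * _), ha, one_mul]

theorem conj_diagonal_apply (hϖ : ϖ ≠ 0) {a : GL (Fin n) l} {lam : Fin n → ℤ}
    (ha : (a : Mat) = Matrix.diagonal fun i => ϖ ^ lam i) (X : Mat) (i j : Fin n) :
    (((a⁻¹ : GL (Fin n) l) : Mat) * X * (a : Mat)) i j = ϖ ^ (lam j - lam i) * X i j := by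
  have ha' : ((a⁻¹ : GL (Fin n) l) : Mat) = Matrix.diagonal fun i => ϖ ^ (-lam i) := by
    rw [Matrix.coe_units_inv, ha]
    refine Matrix.inv_eq_right_inv ?_
    rw [Matrix.diagonal_mul_diagonal, ← Matrix.diagonal_one]
    congr 1
    funext i
    rw [← zpow_add₀ hϖ, add_neg_cancel, zpow_zero]
  rw [ha, ha', Matrix.mul_diagonal, Matrix.diagonal_mul, sub_eq_add_neg, zpow_add₀ hϖ]
  ring

end Cayley

/-! ### The modular character of a group with a Cayley chart -/

section Chart

variable {l : Type*} [Field l] [ValuativeRel l] [TopologicalSpace l]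
  [IsNonarchimedeanLocalField l] {n : ℕ} {ϖ θ : l} {s₀ : ℕ}

local notation "v" => ValuativeRel.valuation l
local notation "Mat" => Matrix (Fin n) (Fin n) l

/-- `ι` identifies `P` with a closed group of upper triangular matrices which near `1` is mapped by
the Cayley transform onto an additive group `𝔤` of matrices. The matrices in `𝔤` are
parametrized by their entries at the positions in `Q`, the entry at `q` being an arbitrary element
of `S q`; every other entry agrees in valuation with one of these or vanishes. The group `Λ`
consists of the valuations of the diagonals of the elements of `P`, and `P` contains the diagonal
matrices `ϖ^λ` with `λ ∈ Λ`. -/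
structure CayleyChart (ϖ θ : l) (s₀ : ℕ) {P : Type*} [Group P] [TopologicalSpace P]
    (ι : P →* GL (Fin n) l) (𝔤 : AddSubgroup (Matrix (Fin n) (Fin n) l))
    (Q : Finset (Fin n × Fin n)) (S : Fin n × Fin n → AddSubgroup l)
    (Λ : AddSubgroup (Fin n → ℤ)) : Prop where
  isUniformizer : IsUniformizer ϖ
  one_le : 1 ≤ s₀
  mem_ball : θ ∈ ball ϖ (1 - s₀)
  isClosedEmbedding : Topology.IsClosedEmbedding ι
  upper : ∀ p, ι p ∈ borelGL l n
  cayley_mem : ∀ p, (ι p : Matrix (Fin n) (Fin n) l) - 1 ∈ matBall n ϖ s₀ → cayley θ (ι p) ∈ 𝔤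
  exists_eq : ∀ X ∈ 𝔤, X ∈ matBall n ϖ s₀ → ∃ p, (ι p : Matrix (Fin n) (Fin n) l) =
    1 + (1 - θ • X)⁻¹ * X
  stable : ∀ q x, ϖ * x ∈ S q ↔ x ∈ S q
  coord_mem : ∀ X ∈ 𝔤, ∀ q ∈ Q, X q.1 q.2 ∈ S q
  exists_coord : ∀ x : Fin n × Fin n → l, (∀ q ∈ Q, x q ∈ S q) →
    ∃ X ∈ 𝔤, ∀ q ∈ Q, X q.1 q.2 = x q
  exists_val_eq : ∀ X ∈ 𝔤, ∀ i j, X i j ≠ 0 → ∃ q ∈ Q, v (X q.1 q.2) = v (X i j) ∧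
    ∀ lam ∈ Λ, lam q.1 - lam q.2 = lam i - lam j
  exists_torus : ∀ lam ∈ Λ, ∃ a, (ι a : Matrix (Fin n) (Fin n) l) =
    Matrix.diagonal fun i => ϖ ^ lam i
  exists_val_diag : ∀ p, ∃ lam ∈ Λ, ∀ i, v (ι p i i) = v ϖ ^ lam i
  exists_strictMono : ∃ rho ∈ Λ, StrictMono rho

namespace CayleyChart

variable {P : Type*} [Group P] [TopologicalSpace P] {ι : P →* GL (Fin n) l}
  {𝔤 : AddSubgroup (Matrix (Fin n) (Fin n) l)} {Q : Finset (Fin n × Fin n)}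
  {S : Fin n × Fin n → AddSubgroup l} {Λ : AddSubgroup (Fin n → ℤ)}
  (C : CayleyChart ϖ θ s₀ ι 𝔤 Q S Λ)

include C

theorem mem_matBall_of_coord {X : Mat} (hX : X ∈ 𝔤) {r : ℤ}
    (h : ∀ q ∈ Q, X q.1 q.2 ∈ ball ϖ r) : X ∈ matBall n ϖ r := fun i j => by
  by_cases h0 : X i j = 0
  · rw [h0]; exact zero_mem _
  · obtain ⟨q, hq, hv, -⟩ := C.exists_val_eq X hX i j h0
    rw [UnramifiedBC.mem_ball, ← hv]
    exact h q hq

/-- The index of a congruence subgroup in a larger group which is described by bounds on the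
coordinates of the Cayley transform. -/
theorem relIndex_eq_prod {M : ℕ} (hM : s₀ ≤ M) {H : Subgroup P} {r : Fin n × Fin n → ℤ}
    (hH : ∀ p, p ∈ H ↔ ι p ∈ congruenceSubgroup (n := n) C.isUniformizer s₀ ∧
      ∀ q ∈ Q, cayley θ (ι p : Mat) q.1 q.2 ∈ ball ϖ (r q))
    (hr : ∀ q ∈ Q, s₀ ≤ r q ∧ r q ≤ M) :
    ((congruenceSubgroup (n := n) C.isUniformizer M).comap ι).relIndex H =
      ∏ q ∈ Q, latIndex ϖ (S q) ^ (M - r q).toNat := by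
  have hϖ := C.isUniformizer
  let L' : Q → AddSubgroup l := fun q => S q ⊓ ball ϖ M
  let L : Q → AddSubgroup l := fun q => S q ⊓ ball ϖ (r q)
  have h1 : ((congruenceSubgroup (n := n) C.isUniformizer M).comap ι).relIndex H =
      (AddSubgroup.pi Set.univ L').relIndex (AddSubgroup.pi Set.univ L) := by
    refine relIndex_eq_of_surjOn (fun p (q : Q) => cayley θ (ι p : Mat) q.1.1 q.1.2) ?_ ?_ ?_
    · intro p hp q _
      obtain ⟨hp1, hp2⟩ := (hH p).1 hp
      exact ⟨C.coord_mem _ (C.cayley_mem p hp1.1) q q.2, hp2 q q.2⟩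
    · intro x hx
      obtain ⟨X, hX, hXx⟩ := C.exists_coord (fun q => if h : q ∈ Q then x ⟨q, h⟩ else 0)
        fun q hq => by rw [dif_pos hq]; exact (hx ⟨q, hq⟩ trivial).1
      have hXx' : ∀ q (hq : q ∈ Q), X q.1 q.2 = x ⟨q, hq⟩ := fun q hq => by
        rw [hXx q hq, dif_pos hq]
      have hXs : X ∈ matBall n ϖ s₀ := C.mem_matBall_of_coord hX fun q hq => by
        rw [hXx' q hq]
        exact ball_mono hϖ (hr q hq).1 (hx ⟨q, hq⟩ trivial).2
      obtain ⟨p, hp⟩ := C.exists_eq X hX hXs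
      obtain ⟨h2, h3⟩ := cayley_eq_of_eq hϖ C.mem_ball hXs hp
      refine ⟨p, (hH p).2 ⟨(mem_congruenceSubgroup_iff hϖ C.one_le).2 h3, fun q hq => ?_⟩, ?_⟩
      · rw [h2, hXx' q hq]
        exact (hx ⟨q, hq⟩ trivial).2
      · funext q
        rw [h2, hXx' q q.2]
    · intro g hg h hh
      obtain ⟨hg1, -⟩ := (hH g).1 hg
      obtain ⟨hh1, -⟩ := (hH h).1 hh
      have hX := add_mem (neg_mem (C.cayley_mem g hg1.1)) (C.cayley_mem h hh1.1)
      rw [Subgroup.mem_comap, mem_congruenceSubgroup_iff hϖ (C.one_le.trans hM), map_mul, map_inv,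
        ← cayley_sub_cayley_mem_iff hϖ C.mem_ball hg1 hh1]
      refine ⟨fun hb q _ => ⟨C.coord_mem _ hX q q.2, hb q.1.1 q.1.2⟩, fun hb => ?_⟩
      exact C.mem_matBall_of_coord hX fun q hq => (hb ⟨q, hq⟩ trivial).2
  rw [h1, relIndex_pi]
  refine Eq.trans ?_ (Finset.prod_coe_sort Q fun q => latIndex ϖ (S q) ^ ((M : ℤ) - r q).toNat)
  refine Finset.prod_congr rfl fun q _ => ?_
  have h2 : (M : ℤ) = r q + ((M - r q).toNat : ℕ) := by
    have := (hr q q.2).2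
    omega
  change (S q ⊓ ball ϖ M).relIndex (S q ⊓ ball ϖ (r q)) = _
  rw [h2, relIndex_inf_ball hϖ (C.stable q)]
  congr 1
  omega

variable [IsTopologicalGroup P]

theorem isOpen_comap (s : ℕ) :
    IsOpen ((congruenceSubgroup (n := n) C.isUniformizer s).comap ι : Set P) :=
  (isOpen_congruenceSubgroup C.isUniformizer s).preimage C.isClosedEmbedding.continuous

theorem isCompact_comap (s : ℕ) :
    IsCompact ((congruenceSubgroup (n := n) C.isUniformizer s).comap ι : Set P) :=
  C.isClosedEmbedding.isCompact_preimage (isCompact_congruenceSubgroup C.isUniformizer s)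

variable [LocallyCompactSpace P]

open MeasureTheory.Measure

/-- The modular character is trivial on the integral elements, as these normalize the congruence
subgroups. -/
theorem modularCharacter_eq_one {κ : P} (hκ : ι κ ∈ maxCompactGL l n) :
    modularCharacter κ = 1 := by
  have hϖ := C.isUniformizer
  have h := modularCharacter_mul_relIndex κ (C.isOpen_comap 1) (C.isCompact_comap 1)
    (C.isCompact_comap 1) le_rfl le_rfl fun x => by
      rw [Subgroup.mem_comap, Subgroup.mem_comap, mem_congruenceSubgroup_iff hϖ le_rfl,
        mem_congruenceSubgroup_iff hϖ le_rfl, map_mul, map_mul, map_inv]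
      have h1 : ((((ι κ)⁻¹ * ι x * ι κ : GL (Fin n) l)) : Mat) - 1 =
          (((ι κ)⁻¹ : GL (Fin n) l) : Mat) * ((ι x : Mat) - 1) * (ι κ : Mat) := by
        rw [mul_sub, sub_mul, mul_one, ← Units.val_mul, ← Units.val_mul, ← Units.val_mul,
          inv_mul_cancel, Units.val_one]
      rw [h1, matBall_mul_mem_iff hϖ hκ, mul_mem_matBall_iff hϖ (inv_mem hκ)]
  simpa using h

/-- The modular character at the element `ϖ^λ` of the torus. -/
theorem modularCharacter_torus {lam : Fin n → ℤ} (hlam : lam ∈ Λ) {a : P}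
    (ha : (ι a : Mat) = Matrix.diagonal fun i => ϖ ^ lam i) :
    ((modularCharacter a : NNReal) : ℝ) =
      ∏ q ∈ Q, (latIndex ϖ (S q) : ℝ) ^ (lam q.2 - lam q.1) := by
  have hϖ := C.isUniformizer
  -- `H = Γ_s` and `H' = a Γ_s a⁻¹`, where `s` is so large that `H' ⊆ Γ_{s₀}` and `Γ_M ⊆ H'`.
  obtain ⟨B, hB⟩ : ∃ B : ℕ, ∀ i, |lam i| ≤ B :=
    ⟨∑ i, (lam i).natAbs, fun i => by
      rw [Int.abs_eq_natAbs]
      exact_mod_cast Finset.single_le_sum (f := fun i => (lam i).natAbs)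
        (fun _ _ => Nat.zero_le _) (Finset.mem_univ i)⟩
  have hdiff : ∀ i j, -(2 * B : ℤ) ≤ lam i - lam j ∧ lam i - lam j ≤ 2 * B := fun i j => by
    have h1 := abs_le.1 (hB i)
    have h2 := abs_le.1 (hB j)
    constructor <;> omega
  set s : ℕ := s₀ + 2 * B with hs
  set M : ℕ := s + 2 * B with hMdef
  have hs1 : 1 ≤ s := C.one_le.trans (by omega)
  have hM1 : 1 ≤ M := hs1.trans (by omega)
  let H : Subgroup P := (congruenceSubgroup (n := n) hϖ s).comap ι
  let H' : Subgroup P := H.map (MulAut.conj a).toMonoidHom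
  have hH' : ∀ x, x ∈ H' ↔ a⁻¹ * x * a ∈ H := fun x => by
    constructor
    · rintro ⟨y, hy, rfl⟩
      have : a⁻¹ * (a * y * a⁻¹) * a = y := by group
      simpa [this] using hy
    · intro hx
      exact ⟨a⁻¹ * x * a, hx, by simp [mul_assoc]⟩
  have hconj : ∀ x : P, ((ι (a⁻¹ * x * a) : GL (Fin n) l) : Mat) =
      (((ι a)⁻¹ : GL (Fin n) l) : Mat) * (ι x : Mat) * (ι a : Mat) := fun x => by
    rw [map_mul, map_mul, map_inv]
    rfl
  have hconj' : ∀ x : P, ((ι (a⁻¹ * x * a) : GL (Fin n) l) : Mat) - 1 =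
      (((ι a)⁻¹ : GL (Fin n) l) : Mat) * ((ι x : Mat) - 1) * (ι a : Mat) := fun x => by
    rw [hconj, mul_sub, sub_mul, mul_one, ← Units.val_mul (ι a)⁻¹ (ι a), inv_mul_cancel,
      Units.val_one]
  have hentry : ∀ (X : Mat) (r : ℤ) i j,
      ((((ι a)⁻¹ : GL (Fin n) l) : Mat) * X * (ι a : Mat)) i j ∈ ball ϖ r ↔
        X i j ∈ ball ϖ (r + (lam i - lam j)) := fun X r i j => by
    rw [conj_diagonal_apply hϖ.ne_zero ha, zpow_mul_mem_ball hϖ]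
    rw [show r - (lam j - lam i) = r + (lam i - lam j) by ring]
  have hH's : H' ≤ (congruenceSubgroup (n := n) hϖ s₀).comap ι := fun x hx => by
    have h1 := ((mem_congruenceSubgroup_iff hϖ hs1).1 ((hH' x).1 hx))
    rw [hconj'] at h1
    refine (mem_congruenceSubgroup_iff hϖ C.one_le).2 fun i j => ?_
    refine ball_mono hϖ ?_ ((hentry _ _ i j).1 (h1 i j))
    have := (hdiff i j).1
    push_cast [hs]
    omega
  have hle : (congruenceSubgroup (n := n) hϖ M).comap ι ≤ H :=
    Subgroup.comap_mono (congruenceSubgroup_mono hϖ (by omega))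
  have hle' : (congruenceSubgroup (n := n) hϖ M).comap ι ≤ H' := fun x hx => by
    refine (hH' x).2 ((mem_congruenceSubgroup_iff hϖ hs1).2 ?_)
    rw [hconj']
    intro i j
    rw [hentry]
    refine ball_mono hϖ ?_ (hx.1 i j)
    have := (hdiff i j).2
    push_cast [hMdef]
    omega
  have hcont : Continuous fun x : P => a * x * a⁻¹ := by fun_prop
  have hH'c : IsCompact (H' : Set P) := (C.isCompact_comap s).image hcont
  have hmod := modularCharacter_mul_relIndex a (C.isOpen_comap M) (C.isCompact_comap s) hH'c
    hle hle' hH'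
  have hidx : ((congruenceSubgroup (n := n) hϖ M).comap ι).relIndex H =
      ∏ q ∈ Q, latIndex ϖ (S q) ^ ((M : ℤ) - s).toNat := by
    refine C.relIndex_eq_prod (r := fun _ => s) (by omega) (fun p => ?_) fun q _ => by omega
    constructor
    · intro hp
      have hp0 := congruenceSubgroup_mono hϖ (show s₀ ≤ s by omega) hp
      exact ⟨hp0, fun q _ => (cayley_mem_matBall_iff hϖ C.mem_ball hp0.1).2 hp.1 _ _⟩
    · rintro ⟨hp0, hp⟩
      refine (mem_congruenceSubgroup_iff hϖ hs1).2 ?_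
      rw [← cayley_mem_matBall_iff hϖ C.mem_ball hp0.1]
      exact C.mem_matBall_of_coord (C.cayley_mem p hp0.1) hp
  have hidx' : ((congruenceSubgroup (n := n) hϖ M).comap ι).relIndex H' =
      ∏ q ∈ Q, latIndex ϖ (S q) ^ ((M : ℤ) - (s + (lam q.1 - lam q.2))).toNat := by
    refine C.relIndex_eq_prod (r := fun q => s + (lam q.1 - lam q.2)) (by omega) (fun p => ?_)
      fun q _ => by have := hdiff q.1 q.2; omega
    constructor
    · intro hp
      have hp0 := hH's hp
      refine ⟨hp0, fun q _ => ?_⟩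
      have hp1 := (hH' p).1 hp
      rw [← hentry, ← cayley_conj, ← hconj]
      exact (cayley_mem_matBall_iff hϖ C.mem_ball
        (congruenceSubgroup_mono hϖ (show s₀ ≤ s by omega) hp1).1).2 hp1.1 _ _
    · rintro ⟨hp0, hp⟩
      refine (hH' p).2 ((mem_congruenceSubgroup_iff hϖ hs1).2 ?_)
      refine sub_one_mem_matBall_of_cayley hϖ C.mem_ball (s₀ := s₀) ?_ (by omega) ?_
      · obtain ⟨κ, -, hκ⟩ := exists_one_add_smul hϖ C.mem_ball hp0.1
        refine ⟨(ι a)⁻¹ * κ * ι a, ?_⟩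
        rw [hconj', Units.val_mul, Units.val_mul, hκ, mul_add, add_mul, mul_one,
          ← Units.val_mul (ι a)⁻¹ (ι a), inv_mul_cancel, Units.val_one, mul_smul_comm,
          smul_mul_assoc]
      · rw [hconj, cayley_conj]
        intro i j
        rw [hentry]
        by_cases h0 : cayley θ (ι p : Mat) i j = 0
        · rw [h0]; exact zero_mem _
        · obtain ⟨q, hq, hv, hq'⟩ := C.exists_val_eq _ (C.cayley_mem p hp0.1) i j h0
          rw [UnramifiedBC.mem_ball, ← hv, ← hq' lam hlam]
          exact hp q hq
  rw [hidx, hidx'] at hmod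
  have hmod' := congrArg (fun x : NNReal => (x : ℝ)) hmod
  push_cast at hmod'
  have hne : ∀ q, (latIndex ϖ (S q) : ℝ) ≠ 0 := fun q => by
    exact_mod_cast latIndex_ne_zero hϖ (S q)
  rw [← div_eq_of_eq_mul (Finset.prod_ne_zero_iff.2 fun q _ => pow_ne_zero _ (hne q)) hmod'.symm,
    ← Finset.prod_div_distrib]
  refine Finset.prod_congr rfl fun q _ => ?_
  rw [← zpow_natCast, ← zpow_natCast, ← zpow_sub₀ (hne q)]
  congr 1
  have := hdiff q.1 q.2
  omega

/-- Every element of `P` is conjugate by a torus element to the product of an integral element and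
a torus element, as conjugation by a suitable torus element contracts unipotent elements. -/
theorem exists_modularCharacter_eq (p : P) : ∃ lam ∈ Λ, ∃ a : P,
    (ι a : Mat) = (Matrix.diagonal fun i => ϖ ^ lam i) ∧
      modularCharacter p = modularCharacter a := by
  have hϖ := C.isUniformizer
  obtain ⟨lam, hlam, hval⟩ := C.exists_val_diag p
  obtain ⟨a, ha⟩ := C.exists_torus lam hlam
  obtain ⟨rho, hrho, hmono⟩ := C.exists_strictMono
  have key : ∀ X : Mat, X.IsUpperTriangular → (∀ i, v (X i i) ≤ 1) →
      ∃ m₀ : ℕ, ∀ m : ℕ, m₀ ≤ m → ∀ i j, X i j ∈ ball ϖ (m * (rho i - rho j)) := by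
    intro X hX hdiag
    choose e he using fun i j => exists_mem_ball hϖ (X i j)
    refine ⟨∑ i, ∑ j, (e i j).natAbs, fun m hm i j => ?_⟩
    rcases lt_trichotomy i j with hij | rfl | hij
    · refine ball_mono hϖ ?_ (he i j)
      have h1 : ((e i j).natAbs : ℤ) ≤ m := by
        refine le_trans ?_ (Int.ofNat_le.2 hm)
        exact_mod_cast (Finset.single_le_sum (f := fun j => (e i j).natAbs)
          (fun _ _ => Nat.zero_le _) (Finset.mem_univ j)).trans
          (Finset.single_le_sum (f := fun i => ∑ j, (e i j).natAbs)
            (fun _ _ => Nat.zero_le _) (Finset.mem_univ i))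
      have h2 := hmono hij
      have h3 : (m : ℤ) * (rho i - rho j) ≤ m * (-1) :=
        mul_le_mul_of_nonneg_left (by omega) (by omega)
      omega
    · rw [sub_self, mul_zero, mem_ball_zero]
      exact hdiag i
    · rw [show X i j = 0 from hX hij]; exact zero_mem _
  have haval : ∀ i, v (ι a i i) = v ϖ ^ lam i := fun i => by
    rw [ha, Matrix.diagonal_apply_eq, map_zpow₀]
  have hne : ∀ i, v ϖ ^ lam i ≠ 0 := fun i => zpow_ne_zero _ hϖ.val_ne_zero
  -- `v` is multiplicative on diagonals of upper triangular matrices.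
  have hdiagmul : ∀ (x y : P) i, v (ι (x * y) i i) = v (ι x i i) * v (ι y i i) := fun x y i => by
    rw [map_mul, ← map_mul (ValuativeRel.valuation l)]
    exact congrArg v (borelGL_diag_mul ⟨ι x, C.upper x⟩ ⟨ι y, C.upper y⟩ i)
  have hinv : ∀ (x : P) i, v (ι x i i) * v (ι x⁻¹ i i) = 1 := fun x i => by
    rw [← hdiagmul, mul_inv_cancel, map_one, Units.val_one, Matrix.one_apply_eq, map_one]
  have hu : ∀ i, v (ι (p * a⁻¹) i i) = 1 := fun i => by
    rw [hdiagmul, hval, ← haval, hinv]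
  obtain ⟨m₁, hm₁⟩ := key (ι (p * a⁻¹)) (C.upper _) fun i => (hu i).le
  obtain ⟨m₂, hm₂⟩ := key (ι (p * a⁻¹)⁻¹) (C.upper _) fun i => by
    have := hinv (p * a⁻¹) i
    rw [hu, one_mul] at this
    exact this.le
  obtain ⟨b, hb⟩ := C.exists_torus (max m₁ m₂ • rho) (nsmul_mem hrho _)
  have hbint : ∀ X : Mat, (∀ i j, X i j ∈ ball ϖ ((max m₁ m₂ : ℕ) * (rho i - rho j))) →
      (((ι b)⁻¹ : GL (Fin n) l) : Mat) * X * (ι b : Mat) ∈ matBall n ϖ 0 := fun X hX i j => by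
    rw [conj_diagonal_apply hϖ.ne_zero hb, zpow_mul_mem_ball hϖ]
    convert hX i j using 2
    simp only [Pi.smul_apply, nsmul_eq_mul]
    ring
  have hκ : ι (b⁻¹ * (p * a⁻¹) * b) ∈ maxCompactGL l n := by
    refine (mem_maxCompactGL_iff (ϖ := ϖ)).2 ⟨?_, ?_⟩
    · rw [map_mul, map_mul ι b⁻¹, map_inv]
      exact hbint _ (hm₁ _ (le_max_left _ _))
    · rw [← map_inv, show (b⁻¹ * (p * a⁻¹) * b)⁻¹ = b⁻¹ * (p * a⁻¹)⁻¹ * b by group,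
        map_mul, map_mul ι b⁻¹, map_inv ι b]
      exact hbint _ (hm₂ _ (le_max_right _ _))
  refine ⟨lam, hlam, a, ha, ?_⟩
  have h1 := C.modularCharacter_eq_one hκ
  have h2 : p = b * (b⁻¹ * (p * a⁻¹) * b) * b⁻¹ * a := by group
  rw [h2, map_mul, map_mul, map_mul, h1, mul_one, ← map_mul, mul_inv_cancel, map_one, one_mul]

/-- If each coordinate contributes a square to the modular character, then the square root of the
modular character has rational values. -/
theorem exists_sqrt_modularCharacter_eq_ratCast
    (hsq : ∀ q ∈ Q, IsSquare (latIndex ϖ (S q)) ∨ ∀ lam ∈ Λ, Even (lam q.1 - lam q.2)) (p : P) :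
    ∃ x : ℚ, ((NNReal.sqrt (modularCharacter p) : NNReal) : ℝ) = x := by
  obtain ⟨lam, hlam, a, ha, hpa⟩ := C.exists_modularCharacter_eq p
  have h1 : ∀ q ∈ Q, ∃ x : ℚ, (latIndex ϖ (S q) : ℝ) ^ (lam q.2 - lam q.1) = (x : ℝ) ^ 2 := by
    intro q hq
    rcases hsq q hq with ⟨N, hN⟩ | heven
    · refine ⟨(N : ℚ) ^ (lam q.2 - lam q.1), ?_⟩
      rw [hN]
      push_cast
      rw [mul_zpow, pow_two]
    · obtain ⟨m, hm⟩ := heven lam hlam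
      refine ⟨(latIndex ϖ (S q) : ℚ) ^ (-m), ?_⟩
      push_cast
      rw [← zpow_natCast, ← zpow_mul]
      congr 1
      push_cast
      omega
  choose! x hx using h1
  refine ⟨|∏ q ∈ Q, x q|, ?_⟩
  rw [hpa, Real.coe_sqrt, C.modularCharacter_torus hlam ha, Finset.prod_congr rfl hx,
    Finset.prod_pow, Real.sqrt_sq_eq_abs]
  push_cast
  rfl

end CayleyChart

end Chart

/-- A field automorphism of `ℂ` fixes `δ_P^{1/2}` if its values are rational. -/
theorem map_sqrtModulus_of_ratCast {G : Type*} [Group G] [TopologicalSpace G]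
    [IsTopologicalGroup G] (P : Subgroup G) [LocallyCompactSpace P] (σ : ℂ ≃+* ℂ) (p : P)
    (h : ∃ x : ℚ, ((NNReal.sqrt (MeasureTheory.Measure.modularCharacter p) : NNReal) : ℝ) = x) :
    σ (sqrtModulus P p) = sqrtModulus P p := by
  obtain ⟨x, hx⟩ := h
  rw [sqrtModulus, hx]
  simp

/-! ### The conjugation of an unramified quadratic extension -/

section Quadratic

variable {k l : Type*} [Field k] [ValuativeRel k] [TopologicalSpace k]
  [IsNonarchimedeanLocalField k] [Field l] [ValuativeRel l] [TopologicalSpace l]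
  [IsNonarchimedeanLocalField l] [Algebra k l] [ValuativeExtension k l]

local notation "v" => ValuativeRel.valuation l

theorem conj_conj [Algebra.IsQuadraticExtension k l] (c : l ≃ₐ[k] l) (x : l) : c (c x) = x := by
  have hcard : Nat.card (l ≃ₐ[k] l) ≤ 2 := by
    rw [← Algebra.IsQuadraticExtension.finrank_eq_two k l, Nat.card_eq_fintype_card]
    exact AlgEquiv.card_le
  have hpos : 0 < Nat.card (l ≃ₐ[k] l) := Nat.card_pos
  have h : c ^ 2 = 1 := by
    have h1 := pow_card_eq_one' (x := c)
    interval_cases Nat.card (l ≃ₐ[k] l)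
    · rw [pow_one] at h1
      rw [h1, one_pow]
    · exact h1
  calc c (c x) = (c ^ 2) x := by rw [pow_two]; rfl
    _ = x := by rw [h]; rfl

theorem exists_add_conj_eq_one [Algebra.IsQuadraticExtension k l] {c : l ≃ₐ[k] l}
    (hc : c ≠ AlgEquiv.refl) : ∃ θ : l, θ + c θ = 1 := by
  by_cases h : ∀ x : l, x + c x = 0
  · refine absurd (AlgEquiv.ext fun x => ?_) hc
    -- The trace of `1` vanishes, so the characteristic is `2` and `c(x) = -x = x`.
    have h2 : (1 : l) + 1 = 0 := by simpa using h 1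
    have h3 : x + x = 0 := by linear_combination x * h2
    change c x = x
    linear_combination h x - h3
  · push Not at h
    obtain ⟨y, hy⟩ := h
    have hfix : c (y + c y) = y + c y := by rw [map_add, conj_conj, add_comm]
    refine ⟨y / (y + c y), ?_⟩
    rw [map_div₀, hfix]
    field_simp

theorem exists_isUniformizer_algebraMap (hkl : IsUnramifiedExtension k l) :
    ∃ ϖ : k, IsUniformizer (algebraMap k l ϖ) := by
  obtain ⟨p, hp⟩ := IsDiscreteValuationRing.exists_irreducible 𝒪[k]
  obtain ⟨q, hq, hqp⟩ := hkl p hp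
  exact ⟨p, q, hq, hqp⟩

variable [FiniteDimensional k l]

/-- `x` is topologically nilpotent if and only if its valuation is less than `1`, so this property
is preserved by continuous automorphisms. -/
theorem val_conj_lt_one (c : l ≃ₐ[k] l) {x : l} (hx : v x < 1) : v (c x) < 1 := by
  have hb := IsValuativeTopology.hasBasis_nhds_zero' l
  have hcont : Filter.Tendsto c (nhds 0) (nhds 0) := by
    simpa using (continuous_algEquiv c).tendsto 0
  obtain ⟨γ, hγ, hγc⟩ := (hb.tendsto_iff hb).1 hcont 1 one_ne_zero
  obtain ⟨m, hm⟩ := exists_pow_lt₀ hx (Units.mk0 γ hγ)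
  have h1 : v (c (x ^ m)) < 1 := hγc (x ^ m) (by rw [← map_pow] at hm; exact hm)
  by_contra h2
  rw [map_pow, map_pow] at h1
  exact absurd h1 (one_le_pow₀ (not_lt.1 h2)).not_gt

theorem val_conj_le_one (c : l ≃ₐ[k] l) {x : l} (hx : v x ≤ 1) : v (c x) ≤ 1 := by
  by_contra h
  have h1 : v (c x)⁻¹ < 1 := by
    rw [map_inv₀]
    exact inv_lt_one_of_one_lt₀ (not_le.1 h)
  have h2 := val_conj_lt_one c.symm h1
  rw [map_inv₀, AlgEquiv.symm_apply_apply, map_inv₀] at h2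
  have h0 : v x ≠ 0 := by
    intro h0
    rw [Valuation.zero_iff] at h0
    simp [h0] at h
  exact absurd h2 (one_le_inv₀ (zero_lt_iff.2 h0) |>.2 hx).not_gt

theorem val_conj {ϖ : k} (hϖ : IsUniformizer (algebraMap k l ϖ)) (c : l ≃ₐ[k] l) (x : l) :
    v (c x) = v x := by
  rcases eq_or_ne x 0 with rfl | hx
  · simp
  have key : ∀ (c : l ≃ₐ[k] l) (x : l), x ≠ 0 → v (c x) ≤ v x := fun c x hx => by
    obtain ⟨m, hm⟩ := hϖ.exists_zpow_of_ne_zero hx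
    have h1 : v (c (algebraMap k l ϖ ^ (-m) * x)) ≤ 1 := by
      refine val_conj_le_one c ?_
      rw [map_mul, map_zpow₀, hm, ← zpow_add₀ hϖ.val_ne_zero, neg_add_cancel, zpow_zero]
    rw [map_mul c, map_zpow₀ c, AlgEquiv.commutes] at h1
    have h2 : algebraMap k l ϖ ^ (-m) * c x ∈ ball (algebraMap k l ϖ) 0 := mem_ball_zero.2 h1
    rw [zpow_mul_mem_ball hϖ, zero_sub, neg_neg, mem_ball, ← hm] at h2
    exact h2
  refine le_antisymm (key c x hx) ?_
  have := key c.symm (c x) (by simpa using hx)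
  rwa [AlgEquiv.symm_apply_apply] at this

/-- The residue cardinality of `l` is a square: for `η` not fixed by `c`, the lattice
`F₀ + F₀ η`, where `F₀` is the ring of fixed integers, is commensurable with `𝒪_l`. -/
theorem isSquare_latIndex_top [Algebra.IsQuadraticExtension k l] {ϖ : k}
    (hϖ : IsUniformizer (algebraMap k l ϖ)) {c : l ≃ₐ[k] l} (hc : c ≠ AlgEquiv.refl) :
    IsSquare (latIndex (algebraMap k l ϖ) (⊤ : AddSubgroup l)) := by
  set p : l := algebraMap k l ϖ with hp
  have hcp : c p = p := c.commutes ϖ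
  obtain ⟨η, hη, hηc⟩ : ∃ η : l, η ∈ ball p 0 ∧ η - c η ≠ 0 := by
    obtain ⟨y, hy⟩ : ∃ y, c y ≠ y := by
      by_contra! h
      exact hc (AlgEquiv.ext h)
    obtain ⟨r, hr⟩ := exists_mem_ball hϖ y
    refine ⟨p ^ (-r) * y, (zpow_mul_mem_ball hϖ).2 (by simpa using hr), ?_⟩
    rw [map_mul, map_zpow₀, hcp, ← mul_sub]
    exact mul_ne_zero (zpow_ne_zero _ hϖ.ne_zero) (sub_ne_zero.2 hy.symm)
  let F : AddSubgroup l :=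
    { carrier := {x | c x = x}
      add_mem' := fun {a b} ha hb => by
        change c (a + b) = a + b
        rw [map_add, show c a = a from ha, show c b = b from hb]
      zero_mem' := map_zero c
      neg_mem' := fun {a} ha => by
        change c (-a) = -a
        rw [map_neg, show c a = a from ha] }
  have hF : ∀ x, x ∈ F ↔ c x = x := fun _ => Iff.rfl
  -- `x = a(x) + b(x) η` with `a(x)` and `b(x)` in `F`.
  let b : l → l := fun x => (x - c x) / (η - c η)
  have hb : ∀ x, b x * (η - c η) = x - c x := fun x => div_mul_cancel₀ _ hηc
  have hbF : ∀ x, b x ∈ F := fun x => by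
    rw [hF]
    apply mul_right_cancel₀ hηc
    have h1 := congrArg c (hb x)
    rw [map_mul, map_sub, map_sub, conj_conj, conj_conj] at h1
    linear_combination -h1 - hb x
  have haF : ∀ x, x - b x * η ∈ F := fun x => by
    rw [hF, map_sub, map_mul, (hF _).1 (hbF x)]
    linear_combination hb x
  let D : l →+ (Fin 2 → l) := AddMonoidHom.mk' (fun x => ![x - b x * η, b x]) fun x y => by
    have h1 : b (x + y) = b x + b y := by
      simp only [b, map_add]
      ring
    ext i
    fin_cases i
    · simp [h1]; ring
    · simp [h1]
  have hD0 : ∀ x, D x 0 = x - b x * η := fun _ => rfl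
  have hD1 : ∀ x, D x 1 = b x := fun _ => rfl
  let L : ℤ → AddSubgroup l := fun r => (AddSubgroup.pi Set.univ fun _ => F ⊓ ball p r).comap D
  have hL : ∀ r x, x ∈ L r ↔ x - b x * η ∈ ball p r ∧ b x ∈ ball p r := fun r x => by
    constructor
    · intro h
      exact ⟨(h 0 trivial).2, (h 1 trivial).2⟩
    · rintro ⟨h0, h1⟩ i -
      fin_cases i
      · exact ⟨haF x, h0⟩
      · exact ⟨hbF x, h1⟩
  have hidx : (L 1).relIndex (L 0) = latIndex p F ^ 2 := by
    have hmap : (L 0).map D = AddSubgroup.pi Set.univ fun _ => F ⊓ ball p 0 := by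
      refine AddSubgroup.map_comap_eq_self fun y hy => ?_
      have hy0 : c (y 0) = y 0 := (hy 0 trivial).1
      have hy1 : c (y 1) = y 1 := (hy 1 trivial).1
      have hb' : b (y 0 + y 1 * η) = y 1 := by
        apply mul_right_cancel₀ hηc
        rw [hb, map_add, map_mul, hy0, hy1]
        ring
      refine ⟨y 0 + y 1 * η, ?_⟩
      ext i
      fin_cases i
      · change D _ 0 = y 0
        rw [hD0, hb']; ring
      · change D _ 1 = y 1
        rw [hD1, hb']
    rw [AddSubgroup.relIndex_comap, hmap, relIndex_pi, Fin.prod_const]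
    rfl
  have hLle : ∀ r, L r ≤ ball p r := fun r x hx => by
    obtain ⟨h0, h1⟩ := (hL r x).1 hx
    have h2 : x = (x - b x * η) + b x * η := by ring
    rw [h2]
    exact add_mem h0 (by simpa using mul_mem_ball hϖ h1 hη)
  have hLmono : L 1 ≤ L 0 := fun x hx => by
    obtain ⟨h0, h1⟩ := (hL 1 x).1 hx
    exact (hL 0 x).2 ⟨ball_mono hϖ zero_le_one h0, ball_mono hϖ zero_le_one h1⟩
  have hne : (L 0).relIndex (ball p 0) ≠ 0 := by
    refine relIndex_ne_zero_of_isOpen_of_isCompact_add ?_ (isCompact_ball p 0)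
    have hcont : Continuous b :=
      (continuous_id.sub (continuous_algEquiv c)).div_const _
    have h1 : (L 0 : Set l) =
        (fun x => x - b x * η) ⁻¹' (ball p 0) ∩ b ⁻¹' (ball p 0) := Set.ext fun x => hL 0 x
    rw [h1]
    exact ((isOpen_ball hϖ 0).preimage
      (continuous_id.sub (hcont.mul continuous_const))).inter ((isOpen_ball hϖ 0).preimage hcont)
  have hscale : (L 1).relIndex (ball p 1) = (L 0).relIndex (ball p 0) := by
    have hinj : Function.Injective (AddMonoidHom.mulLeft p) := mul_right_injective₀ hϖ.ne_zero
    have hmul : ∀ (r : ℤ) x, p * x ∈ ball p (r + 1) ↔ x ∈ ball p r := fun r x => by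
      have := zpow_mul_mem_ball hϖ (r := r + 1) (m := 1) (x := x)
      rwa [zpow_one, add_sub_cancel_right] at this
    have hbp : ∀ x, b (p * x) = p * b x := fun x => by
      simp only [b, map_mul, hcp]
      ring
    have hm : ∀ A B : AddSubgroup l, (∀ x, p * x ∈ B ↔ x ∈ A) →
        A.map (AddMonoidHom.mulLeft p) = B := fun A B h => by
      ext x
      constructor
      · rintro ⟨y, hy, rfl⟩
        exact (h y).2 hy
      · intro hx
        refine ⟨p⁻¹ * x, (h _).1 ?_, ?_⟩
        · rwa [mul_inv_cancel_left₀ hϖ.ne_zero]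
        · exact mul_inv_cancel_left₀ hϖ.ne_zero x
    rw [← AddSubgroup.relIndex_map_map_of_injective (L 0) _ hinj, hm (L 0) (L 1) fun x => ?_,
      hm (ball p 0) (ball p 1) fun x => ?_]
    · exact hmul 0 x
    · rw [hL, hL, hbp, ← hmul 0, ← hmul 0, zero_add, mul_sub, mul_assoc]
  have htop : latIndex p (⊤ : AddSubgroup l) = (ball p 1).relIndex (ball p 0) := by
    rw [latIndex, top_inf_eq, top_inf_eq]
  have h1 := AddSubgroup.relIndex_mul_relIndex _ _ _ hLmono (hLle 0)
  have h2 := AddSubgroup.relIndex_mul_relIndex _ _ _ (hLle 1) (ball_mono hϖ zero_le_one)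
  rw [← h2, hscale, hidx, ← htop, mul_comm] at h1
  exact ⟨latIndex p F, by rw [← pow_two]; exact (Nat.eq_of_mul_eq_mul_left (by omega) h1).symm⟩

end Quadratic

/-! ### The Cayley charts of the two Borel subgroups -/

section Charts

variable {l : Type*} [Field l] [ValuativeRel l] [TopologicalSpace l]
  [IsNonarchimedeanLocalField l] {n : ℕ} {ϖ θ : l} {s₀ : ℕ}

local notation "v" => ValuativeRel.valuation l
local notation "Mat" => Matrix (Fin n) (Fin n) l

theorem isUpperTriangular_smul {X : Mat} (hX : X.IsUpperTriangular) (z : l) :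
    (z • X).IsUpperTriangular := fun i j hij => by
  rw [Matrix.smul_apply, show X i j = 0 from hX hij, smul_zero]

theorem isUpperTriangular_inv {X : Mat} (hX : X.IsUpperTriangular) (h : IsUnit X) :
    (X⁻¹).IsUpperTriangular := by
  have : Invertible X := h.invertible
  exact Matrix.blockTriangular_inv_of_blockTriangular hX

theorem isUpperTriangular_cayley {g : Mat} (hg : g.IsUpperTriangular)
    (h : IsUnit (1 + θ • (g - 1))) : (cayley θ g).IsUpperTriangular := by
  have h1 : (g - 1).IsUpperTriangular := hg.sub Matrix.blockTriangular_one
  exact h1.mul (isUpperTriangular_inv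
    (Matrix.blockTriangular_one.add (isUpperTriangular_smul h1 θ)) h)

theorem isUpperTriangular_one_add {X : Mat} (hX : X.IsUpperTriangular)
    (h : IsUnit (1 - θ • X)) : (1 + (1 - θ • X)⁻¹ * X).IsUpperTriangular :=
  Matrix.blockTriangular_one.add ((isUpperTriangular_inv
    (Matrix.blockTriangular_one.sub (isUpperTriangular_smul hX θ)) h).mul hX)

/-- The additive group of upper triangular matrices. -/
def upperTriangular (l : Type*) [Field l] (n : ℕ) : AddSubgroup (Matrix (Fin n) (Fin n) l) where
  carrier := {X | X.IsUpperTriangular}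
  add_mem' := fun ha hb => ha.add hb
  zero_mem' := Matrix.blockTriangular_zero
  neg_mem' := fun ha => ha.neg

theorem isUnit_one_sub_smul (hϖ : IsUniformizer ϖ) (hθ : θ ∈ ball ϖ (1 - s₀)) {X : Mat}
    (hX : X ∈ matBall n ϖ s₀) : IsUnit (1 - θ • X) := by
  obtain ⟨κ, -, hκ⟩ := exists_one_add_smul hϖ hθ (neg_mem hX)
  exact ⟨κ, by rw [hκ, smul_neg, sub_eq_add_neg]⟩

theorem isUnit_one_add_smul (hϖ : IsUniformizer ϖ) (hθ : θ ∈ ball ϖ (1 - s₀)) {X : Mat}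
    (hX : X ∈ matBall n ϖ s₀) : IsUnit (1 + θ • X) := by
  obtain ⟨κ, -, hκ⟩ := exists_one_add_smul hϖ hθ hX
  exact ⟨κ, hκ⟩

theorem isUnit_one_add_cayleyInv (hϖ : IsUniformizer ϖ) (hθ : θ ∈ ball ϖ (1 - s₀)) (hs : 1 ≤ s₀)
    {X : Mat} (hX : X ∈ matBall n ϖ s₀) : IsUnit (1 + (1 - θ • X)⁻¹ * X) := by
  obtain ⟨-, h⟩ := cayley_eq_of_eq hϖ hθ hX rfl
  obtain ⟨κ, -, hκ⟩ := exists_mem_maxCompactGL_eq_one_add hϖ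
    (matBall_mono hϖ (by exact_mod_cast hs) h)
  exact ⟨κ, by rw [hκ]; abel⟩

theorem isUnit_diagonal_zpow (hϖ : ϖ ≠ 0) (lam : Fin n → ℤ) :
    IsUnit (Matrix.diagonal fun i => ϖ ^ lam i) := by
  rw [Matrix.isUnit_iff_isUnit_det, Matrix.det_diagonal]
  exact IsUnit.mk0 _ (Finset.prod_ne_zero_iff.2 fun i _ => zpow_ne_zero _ hϖ)

theorem cayleyChart_borelGL (hϖ : IsUniformizer ϖ) :
    CayleyChart ϖ 0 1 (borelGL l n).subtype (upperTriangular l n)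
      (Finset.univ.filter fun q => q.1 ≤ q.2) (fun _ => ⊤) ⊤ where
  isUniformizer := hϖ
  one_le := le_rfl
  mem_ball := zero_mem _
  isClosedEmbedding := isClosed_borelGL.isClosedEmbedding_subtypeVal
  upper p := p.2
  cayley_mem p hp := isUpperTriangular_cayley p.2 (isUnit_one_add_smul hϖ (zero_mem _) hp)
  exists_eq X hX hXs := by
    obtain ⟨g, hg⟩ := isUnit_one_add_cayleyInv (θ := 0) hϖ (zero_mem _) le_rfl hXs
    refine ⟨⟨g, ?_⟩, hg⟩
    change (g : Mat).IsUpperTriangular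
    rw [hg]
    exact isUpperTriangular_one_add hX (isUnit_one_sub_smul hϖ (zero_mem _) hXs)
  stable _ _ := by simp
  coord_mem _ _ _ _ := trivial
  exists_coord x _ := by
    refine ⟨Matrix.of fun i j => if i ≤ j then x (i, j) else 0, fun i j hij => ?_, fun q hq => ?_⟩
    · simpa using fun h : i ≤ j => absurd hij h.not_gt
    · simpa using fun h : q.2 < q.1 => absurd (Finset.mem_filter.1 hq).2 h.not_ge
  exists_val_eq X hX i j h0 := by
    refine ⟨(i, j), Finset.mem_filter.2 ⟨Finset.mem_univ _, ?_⟩, rfl, fun _ _ => rfl⟩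
    by_contra h
    exact h0 (hX (not_le.1 h))
  exists_torus lam _ := by
    obtain ⟨g, hg⟩ := isUnit_diagonal_zpow hϖ.ne_zero lam
    refine ⟨⟨g, ?_⟩, hg⟩
    change (g : Mat).IsUpperTriangular
    rw [hg]
    exact Matrix.blockTriangular_diagonal _
  exists_val_diag p := by
    choose lam hlam using fun i => hϖ.exists_zpow_of_ne_zero (borelGL_diag_ne_zero p i)
    exact ⟨lam, trivial, hlam⟩
  exists_strictMono := ⟨fun i => i, trivial, fun i j hij => Int.ofNat_lt.2 hij⟩

variable {k : Type*} [Field k] [Algebra k l]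

/-- The matrix of the hermitian form defining the unitary group. -/
def antidiagonal (l : Type*) [Field l] (n : ℕ) : Matrix (Fin n) (Fin n) l :=
  Matrix.of fun i j : Fin n => if j = i.rev then (1 : l) else 0

local notation "Wm" => antidiagonal l n

theorem mem_unitaryGroup_iff {c : l ≃ₐ[k] l} {g : GL (Fin n) l} :
    g ∈ unitaryGroup n c ↔ ((g : Mat).map c).transpose * Wm * (g : Mat) = Wm := Iff.rfl

theorem antidiagonal_mul_apply (X : Mat) (i j : Fin n) : (Wm * X) i j = X i.rev j := by
  rw [Matrix.mul_apply, Finset.sum_eq_single i.rev]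
  · simp [antidiagonal]
  · intro b _ hb
    simp [antidiagonal, hb]
  · simp

theorem mul_antidiagonal_apply (X : Mat) (i j : Fin n) : (X * Wm) i j = X i j.rev := by
  rw [Matrix.mul_apply, Finset.sum_eq_single j.rev]
  · simp [antidiagonal]
  · intro b _ hb
    have : j ≠ b.rev := fun h => hb (by rw [h, Fin.rev_rev])
    simp [antidiagonal, this]
  · simp

/-- The additive group of upper triangular matrices which are antihermitian with respect to the
form defining the unitary group, i.e. the Lie algebra of the Borel subgroup of `U`. -/
def upperAntihermitian (n : ℕ) (c : l ≃ₐ[k] l) : AddSubgroup (Matrix (Fin n) (Fin n) l) where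
  carrier := {X | X.IsUpperTriangular ∧ ∀ i j, c (X i j) = -X j.rev i.rev}
  add_mem' := fun ha hb => ⟨ha.1.add hb.1, fun i j => by
    rw [Matrix.add_apply, Matrix.add_apply, map_add, ha.2, hb.2, neg_add]⟩
  zero_mem' := ⟨Matrix.blockTriangular_zero, fun i j => by simp⟩
  neg_mem' := fun ha => ⟨ha.1.neg, fun i j => by
    rw [Matrix.neg_apply, Matrix.neg_apply, map_neg, ha.2]⟩

theorem antihermitian_iff {c : l ≃ₐ[k] l} {X : Mat} :
    (∀ i j, c (X i j) = -X j.rev i.rev) ↔ (X.map c).transpose * Wm = -(Wm * X) := by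
  rw [← Matrix.ext_iff]
  simp only [Matrix.neg_apply, mul_antidiagonal_apply, antidiagonal_mul_apply,
    Matrix.transpose_apply, Matrix.map_apply]
  constructor
  · intro h i j
    rw [h, Fin.rev_rev]
  · intro h i j
    have := h j i.rev
    rwa [Fin.rev_rev] at this

theorem map_smul_transpose (c : l ≃ₐ[k] l) (z : l) (X : Mat) :
    ((z • X).map c).transpose = c z • (X.map c).transpose := by
  ext i j
  simp

theorem map_one_add_transpose (c : l ≃ₐ[k] l) (X : Mat) :
    ((1 + X).map c).transpose = 1 + (X.map c).transpose := by
  ext i j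
  simp [Matrix.one_apply, eq_comm, apply_ite c]

theorem map_mul_transpose (c : l ≃ₐ[k] l) (X Y : Mat) :
    ((X * Y).map c).transpose = (Y.map c).transpose * (X.map c).transpose := by
  rw [Matrix.map_mul, Matrix.transpose_mul]

theorem isUnit_map_transpose (c : l ≃ₐ[k] l) {X : Mat} (hX : IsUnit X) :
    IsUnit (X.map c).transpose := by
  rw [Matrix.isUnit_transpose]
  exact hX.map (c : l →+* l).mapMatrix

/-- The Cayley transform of a unitary matrix is antihermitian: multiplied by `1 + θY` on the right
and by its conjugate transpose on the left, where `Y = g - 1`, the antihermitian equation becomes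
`Y^* w + w Y + Y^* w Y = 0`, since `θ + c(θ) = 1`. -/
theorem antihermitian_cayley {c : l ≃ₐ[k] l} (hθ : θ + c θ = 1) {g : Mat}
    (hg : (g.map c).transpose * Wm * g = Wm) (hu : IsUnit (1 + θ • (g - 1))) :
    ((cayley θ g).map c).transpose * Wm = -(Wm * cayley θ g) := by
  set Y := g - 1 with hY
  have hX : cayley θ g * (1 + θ • Y) = Y := cayley_mul_eq hu
  set X := cayley θ g
  have hgY : g = 1 + Y := by rw [hY]; abel
  rw [hgY, map_one_add_transpose] at hg
  set Y' := (Y.map c).transpose with hY'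
  have hu' : IsUnit (1 + c θ • Y') := by
    have := isUnit_map_transpose c hu
    rwa [map_one_add_transpose, map_smul_transpose] at this
  have hX' : (1 + c θ • Y') * (X.map c).transpose = Y' := by
    rw [hY', ← map_smul_transpose, ← map_one_add_transpose, ← map_mul_transpose, hX]
  have h1 : Y' * Wm + Wm * Y + Y' * Wm * Y = 0 := by
    have h2 : (1 + Y') * Wm * (1 + Y) = Wm + (Y' * Wm + Wm * Y + Y' * Wm * Y) := by noncomm_ring
    rw [h2] at hg
    simpa using hg
  rw [← add_eq_zero_iff_eq_neg]
  refine hu'.mul_left_cancel (hu.mul_right_cancel ?_)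
  calc (1 + c θ • Y') * ((X.map c).transpose * Wm + Wm * X) * (1 + θ • Y)
      = ((1 + c θ • Y') * (X.map c).transpose) * Wm * (1 + θ • Y) +
        (1 + c θ • Y') * Wm * (X * (1 + θ • Y)) := by
          generalize 1 + c θ • Y' = A
          generalize 1 + θ • Y = B
          rw [mul_add, add_mul]
          simp only [mul_assoc]
    _ = Y' * Wm + Wm * Y + (θ + c θ) • (Y' * Wm * Y) := by
      rw [hX, hX', mul_add, mul_smul_comm, add_mul, add_mul, smul_mul_assoc, smul_mul_assoc,
        add_smul, mul_one, one_mul]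
      abel
    _ = (1 + c θ • Y') * 0 * (1 + θ • Y) := by rw [hθ, one_smul, h1]; simp

/-- With `A = 1 - θX` and `B = 1 + (1 - θ)X`, so that `g = A⁻¹B`, both `B^* w B` and `A^* w A` equal
`w A B`. -/
theorem unitary_one_add {c : l ≃ₐ[k] l} (hc : ∀ x, c (c x) = x) (hθ : θ + c θ = 1) {X : Mat}
    (hX : (X.map c).transpose * Wm = -(Wm * X)) (hu : IsUnit (1 - θ • X)) :
    ((1 + (1 - θ • X)⁻¹ * X).map c).transpose * Wm * (1 + (1 - θ • X)⁻¹ * X) = Wm := by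
  set g : Mat := 1 + (1 - θ • X)⁻¹ * X with hg
  set A : Mat := 1 - θ • X with hA
  have hAX : Commute A X := (Commute.one_left X).sub_left ((Commute.refl X).smul_left θ)
  have hAX' : A⁻¹ * X = X * A⁻¹ := by
    obtain ⟨κ, hκ⟩ := hu
    rw [← hκ, ← Matrix.coe_units_inv]
    rw [← hκ] at hAX
    exact hAX.units_inv_left
  have hdet := (Matrix.isUnit_iff_isUnit_det _).1 hu
  have hcθ : c θ = 1 - θ := by linear_combination hθ
  have hgA : g * A = 1 + c θ • X := by
    rw [hg, add_mul, one_mul, hAX', mul_assoc, Matrix.nonsing_inv_mul _ hdet, mul_one, hA, hcθ,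
      sub_smul, one_smul]
    abel
  have hA' : (A.map c).transpose = 1 + (-c θ) • (X.map c).transpose := by
    have : A = 1 + (-θ) • X := by rw [hA, neg_smul, sub_eq_add_neg]
    rw [this, map_one_add_transpose, map_smul_transpose, map_neg]
  have hB' : ((1 + c θ • X).map c).transpose = 1 + θ • (X.map c).transpose := by
    rw [map_one_add_transpose, map_smul_transpose, hc]
  refine (isUnit_map_transpose c hu).mul_left_cancel (hu.mul_right_cancel ?_)
  have h1 : (A.map c).transpose * ((g.map c).transpose * Wm * g) * A =
      ((g * A).map c).transpose * Wm * (g * A) := by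
    rw [map_mul_transpose]
    noncomm_ring
  rw [h1, hgA, hB', hA']
  have h2 : ∀ z : l, (1 + z • (X.map c).transpose) * Wm = Wm * (1 + (-z) • X) := fun z => by
    rw [add_mul, mul_add, smul_mul_assoc, hX, one_mul, mul_one, mul_smul_comm, smul_neg, neg_smul]
  rw [h2, h2, mul_assoc, mul_assoc, neg_neg, hA, neg_smul, ← sub_eq_add_neg]
  congr 1
  rw [sub_mul, mul_sub, one_mul, mul_one, smul_mul_assoc, mul_smul_comm, mul_add, add_mul, mul_one,
    one_mul, mul_smul_comm, smul_mul_assoc]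

end Charts

section ChartU

variable {k l : Type*} [Field k] [ValuativeRel k] [TopologicalSpace k]
  [IsNonarchimedeanLocalField k] [Field l] [ValuativeRel l] [TopologicalSpace l]
  [IsNonarchimedeanLocalField l] [Algebra k l] [ValuativeExtension k l] [FiniteDimensional k l]
  {n : ℕ}

local notation "v" => ValuativeRel.valuation l
local notation "Mat" => Matrix (Fin n) (Fin n) l
local notation "Wm" => antidiagonal l n

/-- The elements of trace zero. -/
def traceZero (c : l ≃ₐ[k] l) : AddSubgroup l where
  carrier := {x | c x = -x}
  add_mem' := fun {a b} ha hb => by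
    change c (a + b) = -(a + b)
    rw [map_add, show c a = -a from ha, show c b = -b from hb, neg_add]
  zero_mem' := by
    change c 0 = -0
    simp
  neg_mem' := fun {a} ha => by
    change c (-a) = - -a
    rw [map_neg, show c a = -a from ha]

/-- The valuations `λ` of the diagonals of unitary matrices: `λ_{n+1-i} = -λ_i`. -/
def antisymmetricWeights (n : ℕ) : AddSubgroup (Fin n → ℤ) where
  carrier := {lam | ∀ i, lam i.rev = -lam i}
  add_mem' := fun ha hb i => by
    rw [Pi.add_apply, Pi.add_apply, ha, hb, neg_add]
  zero_mem' := fun i => by simp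
  neg_mem' := fun ha i => by rw [Pi.neg_apply, Pi.neg_apply, ha]

theorem map_diag_mul_diag_rev {c : l ≃ₐ[k] l} {g : GL (Fin n) l} (hg : g ∈ unitaryGroup n c)
    (hg' : g ∈ borelGL l n) (i : Fin n) : c (g i i) * g i.rev i.rev = 1 := by
  have h := congrFun (congrFun (mem_unitaryGroup_iff.1 hg) i) i.rev
  rw [mul_assoc, Matrix.mul_apply, Finset.sum_eq_single i] at h
  · rw [antidiagonal_mul_apply] at h
    simpa [antidiagonal] using h
  · intro j _ hj
    rw [antidiagonal_mul_apply, Matrix.transpose_apply, Matrix.map_apply]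
    rcases lt_or_gt_of_ne hj with h1 | h1
    · rw [show (g : Mat) j.rev i.rev = 0 from hg' (Fin.rev_lt_rev.2 h1), mul_zero]
    · rw [show (g : Mat) j i = 0 from hg' h1, map_zero, zero_mul]
  · simp

open Classical in
/-- Reflection in the antidiagonal determines the entries of an antihermitian matrix below the
antidiagonal by those above it, and those on the antidiagonal have trace zero. So the coordinates
are the positions `(i, j)` with `i ≤ j ≤ n + 1 - i`. -/
theorem cayleyChart_borelU {ϖ : k} (hϖ : IsUniformizer (algebraMap k l ϖ)) {c : l ≃ₐ[k] l}
    (hc : ∀ x, c (c x) = x) {θ : l} (hθ : θ + c θ = 1) {s₀ : ℕ} (hs : 1 ≤ s₀)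
    (hθs : θ ∈ ball (algebraMap k l ϖ) (1 - s₀)) :
    CayleyChart (algebraMap k l ϖ) θ s₀ ((unitaryGroup n c).subtype.comp (borelU c).subtype)
      (upperAntihermitian n c) (Finset.univ.filter fun q => q.1 ≤ q.2 ∧ q.1 ≤ q.2.rev)
      (fun q => if q.2 = q.1.rev then traceZero c else ⊤) (antisymmetricWeights n) where
  isUniformizer := hϖ
  one_le := hs
  mem_ball := hθs
  isClosedEmbedding := (isClosed_unitaryGroup c).isClosedEmbedding_subtypeVal.comp
    (isClosed_borelGL.preimage continuous_subtype_val).isClosedEmbedding_subtypeVal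
  upper p := p.2
  cayley_mem p hp := by
    have hu := isUnit_one_add_smul hϖ hθs hp
    exact ⟨isUpperTriangular_cayley p.2 hu,
      antihermitian_iff.2 (antihermitian_cayley hθ p.1.2 hu)⟩
  exists_eq X hX hXs := by
    obtain ⟨g, hg⟩ := isUnit_one_add_cayleyInv hϖ hθs hs hXs
    have hu := isUnit_one_sub_smul hϖ hθs hXs
    refine ⟨⟨⟨g, ?_⟩, ?_⟩, hg⟩
    · rw [mem_unitaryGroup_iff, hg]
      exact unitary_one_add hc hθ (antihermitian_iff.1 hX.2) hu
    · change (g : Mat).IsUpperTriangular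
      rw [hg]
      exact isUpperTriangular_one_add hX.1 hu
  stable q x := by
    split_ifs
    · change c _ = -_ ↔ c x = -x
      rw [map_mul, AlgEquiv.commutes, ← mul_neg]
      exact mul_right_inj' hϖ.ne_zero
    · exact Iff.rfl
  coord_mem X hX q _ := by
    split_ifs with h
    · change c _ = -_
      rw [hX.2, h, Fin.rev_rev]
    · trivial
  exists_coord x hx := by
    refine ⟨Matrix.of fun i j => if i ≤ j then (if i ≤ j.rev then x (i, j)
      else -c (x (j.rev, i.rev))) else 0, ⟨fun i j hij => ?_, fun i j => ?_⟩, fun q hq => ?_⟩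
    · exact if_neg (not_le.2 hij)
    · simp only [Matrix.of_apply, Fin.rev_le_rev, Fin.rev_rev]
      by_cases hij : i ≤ j
      · simp only [hij, if_true]
        rcases lt_trichotomy i j.rev with h | h | h
        · rw [if_pos h.le, if_neg (not_le.2 h), neg_neg]
        · have h' : j = i.rev := by rw [h, Fin.rev_rev]
          subst h'
          have := hx (i, i.rev) (Finset.mem_filter.2 ⟨Finset.mem_univ _, hij, h.le⟩)
          rw [if_pos rfl] at this
          simp only [Fin.rev_rev, le_refl, if_true]
          exact this
        · rw [if_neg (not_le.2 h), if_pos h.le, map_neg, hc]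
      · simp [hij]
    · obtain ⟨-, h1, h2⟩ := Finset.mem_filter.1 hq
      simp [h1, h2]
  exists_val_eq X hX i j h0 := by
    have hij : i ≤ j := by
      by_contra h
      exact h0 (hX.1 (not_le.1 h))
    by_cases h : i ≤ j.rev
    · exact ⟨(i, j), Finset.mem_filter.2 ⟨Finset.mem_univ _, hij, h⟩, rfl, fun _ _ => rfl⟩
    · refine ⟨(j.rev, i.rev), Finset.mem_filter.2 ⟨Finset.mem_univ _, Fin.rev_le_rev.2 hij, ?_⟩,
        ?_, fun lam hlam => ?_⟩
      · rw [Fin.rev_rev]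
        exact (not_le.1 h).le
      · rw [← val_conj hϖ c (X i j), hX.2, Valuation.map_neg]
      · rw [hlam, hlam]
        ring
  exists_torus lam hlam := by
    obtain ⟨g, hg⟩ := isUnit_diagonal_zpow hϖ.ne_zero lam
    refine ⟨⟨⟨g, ?_⟩, ?_⟩, hg⟩
    · rw [mem_unitaryGroup_iff, hg]
      have h1 : ((Matrix.diagonal fun i => algebraMap k l ϖ ^ lam i : Mat).map c).transpose =
          Matrix.diagonal fun i => algebraMap k l ϖ ^ lam i := by
        rw [Matrix.diagonal_map (map_zero c), Matrix.diagonal_transpose]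
        congr 1
        funext i
        rw [map_zpow₀, AlgEquiv.commutes]
      rw [h1]
      ext i j
      rw [Matrix.mul_diagonal, Matrix.diagonal_mul]
      simp only [antidiagonal, Matrix.of_apply]
      split_ifs with h
      · rw [h, hlam i, mul_one, ← zpow_add₀ hϖ.ne_zero, add_neg_cancel, zpow_zero]
      · simp
    · change (g : Mat).IsUpperTriangular
      rw [hg]
      exact Matrix.blockTriangular_diagonal _
  exists_val_diag p := by
    choose lam hlam using fun i =>
      hϖ.exists_zpow_of_ne_zero (borelGL_diag_ne_zero ⟨p.1.1, p.2⟩ i)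
    refine ⟨lam, fun i => ?_, hlam⟩
    have h1 := congrArg v (map_diag_mul_diag_rev p.1.2 p.2 i)
    rw [map_mul, map_one, val_conj hϖ, hlam, hlam, ← zpow_add₀ hϖ.val_ne_zero] at h1
    have h2 : lam i + lam i.rev = 0 := by
      rw [← zpow_zero (v (algebraMap k l ϖ))] at h1
      exact le_antisymm (hϖ.zpow_le_zpow_iff.1 h1.ge) (hϖ.zpow_le_zpow_iff.1 h1.le)
    omega
  exists_strictMono := by
    refine ⟨fun i => (i : ℤ) - (i.rev : ℕ), fun i => by simp, fun i j hij => ?_⟩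
    have h1 : (i : ℕ) < j := hij
    have h2 : (j.rev : ℕ) < i.rev := Fin.rev_lt_rev.2 hij
    simp only
    omega

end ChartU

/-! ### Satake parameters and conjugation -/

section Final

variable {k l : Type*} [Field k] [ValuativeRel k] [TopologicalSpace k]
  [IsNonarchimedeanLocalField k] [Field l] [ValuativeRel l] [TopologicalSpace l]
  [IsNonarchimedeanLocalField l] [Algebra k l] [ValuativeExtension k l]
  [Algebra.IsQuadraticExtension k l] {n : ℕ}

theorem map_sqrtModulus_borelGL (hkl : IsUnramifiedExtension k l) {c : l ≃ₐ[k] l}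
    (hc : c ≠ AlgEquiv.refl) (σ : ℂ ≃+* ℂ) (p : borelGL l n) :
    σ (sqrtModulus (borelGL l n) p) = sqrtModulus (borelGL l n) p := by
  obtain ⟨ϖ, hϖ⟩ := exists_isUniformizer_algebraMap hkl
  exact map_sqrtModulus_of_ratCast _ σ p
    ((cayleyChart_borelGL hϖ).exists_sqrt_modularCharacter_eq_ratCast
      (fun _ _ => Or.inl (isSquare_latIndex_top hϖ hc)) p)

theorem map_sqrtModulus_borelU (hkl : IsUnramifiedExtension k l) {c : l ≃ₐ[k] l}
    (hc : c ≠ AlgEquiv.refl) (σ : ℂ ≃+* ℂ) (p : borelU (n := n) c) :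
    σ (sqrtModulus (borelU c) p) = sqrtModulus (borelU c) p := by
  obtain ⟨ϖ, hϖ⟩ := exists_isUniformizer_algebraMap hkl
  obtain ⟨θ, hθ⟩ := exists_add_conj_eq_one hc
  obtain ⟨r, hr⟩ := exists_mem_ball hϖ θ
  have hθs : θ ∈ ball (algebraMap k l ϖ) (1 - (r.natAbs + 1 : ℕ)) :=
    ball_mono hϖ (by have := neg_abs_le r; push_cast; omega) hr
  refine map_sqrtModulus_of_ratCast _ σ p
    ((cayleyChart_borelU hϖ (conj_conj c) hθ (by omega) hθs).exists_sqrt_modularCharacter_eq_ratCast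
      (fun q _ => ?_) p)
  by_cases h : q.2 = q.1.rev
  · refine Or.inr fun lam hlam => ?_
    rw [h, hlam, sub_neg_eq_add]
    exact ⟨_, rfl⟩
  · rw [if_neg h]
    exact Or.inl (isSquare_latIndex_top hϖ hc)

theorem unramifiedChar_map (σ : ℂ ≃+* ℂ) (t : Fin n → ℂˣ) (b : borelGL l n) :
    (unramifiedChar (fun i => Units.map (σ : ℂ →* ℂ) (t i)) b : ℂ) = σ (unramifiedChar t b) := by
  change ((∏ i, Units.map (σ : ℂ →* ℂ) (t i) ^ ord l ((b : GL (Fin n) l) i i) : ℂˣ) : ℂ) =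
    σ ((∏ i, t i ^ ord l ((b : GL (Fin n) l) i i) : ℂˣ) : ℂ)
  simp [Units.coe_prod, map_prod]

theorem baseChangeParam_map (σ : ℂ ≃+* ℂ) (t : Fin n → ℂˣ) :
    baseChangeParam (fun i => Units.map (σ : ℂ →* ℂ) (t i)) =
      fun i => Units.map (σ : ℂ →* ℂ) (baseChangeParam t i) := by
  funext i
  simp only [baseChangeParam_apply, map_div]

theorem HasSatakeParameterGL.conjRep (hkl : IsUnramifiedExtension k l) {c : l ≃ₐ[k] l}
    (hc : c ≠ AlgEquiv.refl) (σ : ℂ ≃+* ℂ) {W : Type*} [AddCommGroup W] [Module ℂ W]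
    {ρ : Representation ℂ (GL (Fin n) l) W} {t : Fin n → ℂˣ} (h : HasSatakeParameterGL ρ t) :
    HasSatakeParameterGL (conjRep σ ρ) fun i => Units.map (σ : ℂ →* ℂ) (t i) where
  unramified := h.unramified.conjRep σ
  isSubquotient := h.isSubquotient.conjRep σ (map_sqrtModulus_borelGL hkl hc σ)
    (unramifiedChar_map σ t)

theorem HasSatakeParameterU.conjRep (hkl : IsUnramifiedExtension k l) {c : l ≃ₐ[k] l}
    (hc : c ≠ AlgEquiv.refl) (σ : ℂ ≃+* ℂ) {V : Type*} [AddCommGroup V] [Module ℂ V]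
    {π : Representation ℂ (unitaryGroup n c) V} {t : Fin n → ℂˣ} (h : HasSatakeParameterU c π t) :
    HasSatakeParameterU c (conjRep σ π) fun i => Units.map (σ : ℂ →* ℂ) (t i) where
  unramified := h.unramified.conjRep σ
  isSubquotient := h.isSubquotient.conjRep σ (map_sqrtModulus_borelU hkl hc σ)
    fun _ => unramifiedChar_map σ t _

theorem HasSatakeParameterU.of_conjRep (hkl : IsUnramifiedExtension k l) {c : l ≃ₐ[k] l}
    (hc : c ≠ AlgEquiv.refl) (σ : ℂ ≃+* ℂ) {V : Type*} [AddCommGroup V] [Module ℂ V]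
    {π : Representation ℂ (unitaryGroup n c) V} (hπ : IsUnramified (maxCompactU c) π)
    {t : Fin n → ℂˣ}
    (h : HasSatakeParameterU c (UnramifiedBC.conjRep σ π)
      fun i => Units.map (σ : ℂ →* ℂ) (t i)) : HasSatakeParameterU c π t where
  unramified := hπ
  isSubquotient := h.isSubquotient.of_conjRep σ (map_sqrtModulus_borelU hkl hc σ)
    fun _ => unramifiedChar_map σ t _

theorem HasSatakeParameterGL.nonempty_equiv {W W' : Type*} [AddCommGroup W] [Module ℂ W]
    [AddCommGroup W'] [Module ℂ W'] {ρ : Representation ℂ (GL (Fin n) l) W}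
    {ρ' : Representation ℂ (GL (Fin n) l) W'} {t : Fin n → ℂˣ}
    (h : HasSatakeParameterGL ρ t) (h' : HasSatakeParameterGL ρ' t) : Nonempty (ρ.Equiv ρ') :=
  nonempty_equiv_of_isSubquotient isCompact_maxCompactGL (isSmoothRep_inducedRep _ _)
    (exists_smul_of_fixed_inducedRep _) h.unramified h'.unramified h.isSubquotient h'.isSubquotient

theorem IsBaseChange.conjRep (hkl : IsUnramifiedExtension k l) {c : l ≃ₐ[k] l}
    (hc : c ≠ AlgEquiv.refl) (σ : ℂ ≃+* ℂ) {V : Type*} [AddCommGroup V] [Module ℂ V]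
    {π : Representation ℂ (unitaryGroup n c) V} {W : Type*} [AddCommGroup W] [Module ℂ W]
    {ρ : Representation ℂ (GL (Fin n) l) W} (h : IsBaseChange c π ρ) :
    IsBaseChange c (conjRep σ π) (conjRep σ ρ) := by
  obtain ⟨t, ht⟩ := h.exists_param
  refine ⟨⟨_, ht.conjRep hkl hc σ⟩, fun s hs => ?_⟩
  have hst : s = fun i => Units.map (σ : ℂ →* ℂ) (Units.map (σ.symm : ℂ →* ℂ) (s i)) := by
    funext i
    ext
    simp
  rw [hst] at hs ⊢
  rw [baseChangeParam_map]
  exact (h.param _ (HasSatakeParameterU.of_conjRep hkl hc σ ht.unramified hs)).conjRep hkl hc σ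

end Final

end UnramifiedBC

theorem mainTheorem7
    {k l : Type*} [Field k] [ValuativeRel k] [TopologicalSpace k] [IsNonarchimedeanLocalField k]
    [Field l] [ValuativeRel l] [TopologicalSpace l] [IsNonarchimedeanLocalField l]
    [Algebra k l] [ValuativeExtension k l] [Algebra.IsQuadraticExtension k l]
    (hkl : UnramifiedBC.IsUnramifiedExtension k l)
    (c : l ≃ₐ[k] l) (hc : c ≠ AlgEquiv.refl) (n : ℕ) (σ : ℂ ≃+* ℂ)
    {V : Type*} [AddCommGroup V] [Module ℂ V]
    (π : Representation ℂ (UnramifiedBC.unitaryGroup n c) V)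
    (hπ : UnramifiedBC.IsUnramified (UnramifiedBC.maxCompactU c) π)
    {W : Type*} [AddCommGroup W] [Module ℂ W]
    (ρ : Representation ℂ (GL (Fin n) l) W)
    (hρ : UnramifiedBC.IsBaseChange c π ρ) :
    UnramifiedBC.IsUnramified (UnramifiedBC.maxCompactU c) (UnramifiedBC.conjRep σ π) ∧
    UnramifiedBC.IsBaseChange c (UnramifiedBC.conjRep σ π) (UnramifiedBC.conjRep σ ρ) ∧
    ∀ {W' : Type*} [AddCommGroup W'] [Module ℂ W'] (ρ' : Representation ℂ (GL (Fin n) l) W'),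
      UnramifiedBC.IsBaseChange c (UnramifiedBC.conjRep σ π) ρ' →
        Nonempty (ρ'.Equiv (UnramifiedBC.conjRep σ ρ)) := by
  have h := hρ.conjRep hkl hc σ
  refine ⟨hπ.conjRep σ, h, fun ρ' hρ' => ?_⟩
  obtain ⟨t, ht⟩ := h.exists_param
  exact (hρ'.param t ht).nonempty_equiv (h.param t ht)
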